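/- **Theorem 1 (convergence of gradient descent–proximal mirror ascent).** Let $\Delta\subset\mathbb R^n$ be the probability simplex, $f:\mathbb R^d\times\Delta\to\mathbb R$, $h:\Delta\to\mathbb R$, and $\mathrm{KL}(p,q)=\sum_i p_i\log(p_i/q_i)$ (with value $+\infty$ if $p_i>0=q_i$ for some $i$). Consider $\min_\theta\max_{\pi\in\Delta} f(\theta,\pi)+h(\pi)$ and put $$F(\theta)=\max_{\pi\in\Delta}\bigl(f(\theta,\pi)+h(\pi)\bigr),\qquad F_{1/2L}(\theta)=\min_w\bigl(F(w)+L\|w-\theta\|^2\bigr),\qquad F^*_{1/2L}=\inf_\theta F_{1/2L}(\theta),\qquad h^*=\max_{\Delta}h .$$ Let $L>0$, $l,\sigma,G,R\ge 0$, and assume: (i) for every $\pi\in\Delta$, $\theta\mapsto f(\theta,\pi)+h(\pi)$ is $l$-Lipschitz and differentiable with $L$-Lipschitz gradient; $f(\theta,\cdot)$ and $h$ are concave and continuous on $\Delta$; and $F$ is bounded below; (ii) for an integer $T\ge1$, starting from a deterministic $(\theta_0,\pi_0)$ with $\pi_0\in\Delta$, the iterates satisfy almost surely, for $0\le t<T$,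 with $\eta_\theta=T^{-3/4}$ and $\lambda=T^{-1/4}$, $$\theta_{t+1}=\theta_t-\eta_\theta\, g_t^\theta,\qquad \pi_{t+1}\in\operatorname*{argmax}_{\pi\in\Delta}\ h(\pi)+\langle g_t^\pi,\pi\rangle-\tfrac1{2\lambda}\mathrm{KL}(\pi,\pi_t),$$ and are adapted to a filtration $(\mathcal F_t)$; (iii) the stochastic gradients are square integrable, $\mathbb E[g_t^\theta\mid\mathcal F_t]=\nabla_\theta f(\theta_t,\pi_t)$, $\mathbb E[g_t^\pi\mid\mathcal F_t]=\nabla_\pi f(\theta_t,\pi_t)$ (a gradient of $f(\theta_t,\cdot)$ along $\Delta$), $\mathbb E\|g_t^\theta-\mathbb E[g_t^\theta\mid\mathcal F_t]\|^2\le\sigma^2$ and $\mathbb E\|g_t^\pi\|_\infty^2\le G^2$; (iv) for some $p_{\rm emp}\in\Delta$ and $\alpha>0$ with $p_{{\rm emp},i}\ge\alpha$ for all $i$, every iterate $\pi_t$, $0\le t<T$, satisfies $\mathrm{KL}(p_{\rm emp},\pi_t)\le R$ almost surely. Then $F_{1/2L}$ is differentiable, $\|\nabla F_{1/2L}(\theta_t)\|^2$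 is integrable for $t<T$, and $$\frac1T\sum_{t=0}^{T-1}\mathbb E\|\nabla F_{1/2L}(\theta_t)\|^2\ \le\ \frac{C}{T^{1/4}}+\frac{4L\,(h^*-h(\pi_0))}{T}=O(T^{-1/4}),$$ $$C=2\bigl(F_{1/2L}(\theta_0)-F^*_{1/2L}\bigr)+4L\Bigl(\frac{R+1}{\alpha}+G^2+l\sqrt{l^2+\sigma^2}\Bigr)+2L\,(l^2+\sigma^2).$$ Consequently, for every $\varepsilon>0$, if $T\ge \bigl(C+4L(h^*-h(\pi_0))\bigr)^4\varepsilon^{-8}$, then $\frac1T\sum_{t=0}^{T-1}\mathbb E\|\nabla F_{1/2L}(\theta_t)\|\le\varepsilon$ (i.e. a uniformly random iterate is $\varepsilon$-stationary in expectation), and some $t<T$ has $\mathbb E\|\nabla F_{1/2L}(\theta_t)\|\le\varepsilon$: an $\varepsilon$-stationary point is found in $O(\varepsilon^{-8})$ iterations. -/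

import Mathlib

open MeasureTheory ProbabilityTheory

noncomputable section

namespace SaddlePoint

/-- Kullback–Leibler divergence `KL(p, q) = ∑ i, p i * log (p i / q i)` of two vectors of the
probability simplex, equal to `⊤` when `p` is not absolutely continuous with respect to `q`. -/
def klDiv {n : ℕ} (p q : Fin n → ℝ) : EReal :=
  open Classical in
  if ∀ i, q i = 0 → p i = 0 then ((∑ i, p i * Real.log (p i / q i) : ℝ) : EReal) else ⊤

/-- The primal function `F(x) = max_{p ∈ Δ} (f(x, p) + h(p))`, `Δ` the probability simplex. -/
def primal {d n : ℕ} (f : EuclideanSpace ℝ (Fin d) → (Fin n → ℝ) → ℝ) (h : (Fin n → ℝ) → ℝ)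
    (x : EuclideanSpace ℝ (Fin d)) : ℝ :=
  sSup ((fun p => f x p + h p) '' stdSimplex ℝ (Fin n))

/-- Moreau envelope `F_ρ(x) = min_w (F(w) + ‖w - x‖² / (2ρ))`. For `ρ = 1 / (2L)` the quadratic
term is `L * ‖w - x‖²`. -/
def moreauEnvelope {d : ℕ} (F : EuclideanSpace ℝ (Fin d) → ℝ) (ρ : ℝ)
    (x : EuclideanSpace ℝ (Fin d)) : ℝ :=
  ⨅ w, (F w + (1 / (2 * ρ)) * ‖w - x‖ ^ 2)

/-- `v` is a gradient at `p` of the function `φ` on the probability simplex: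
`φ q = φ p + ∑ i, v i * (q i - p i) + o(‖q - p‖)` as `q → p` in the simplex. Every ambient gradient
of a differentiable extension of `φ` is one. -/
def HasSimplexGradientAt {n : ℕ} (φ : (Fin n → ℝ) → ℝ) (v p : Fin n → ℝ) : Prop :=
  HasFDerivWithinAt φ (∑ i, v i • ContinuousLinearMap.proj (R := ℝ) (φ := fun _ : Fin n => ℝ) i)
    (stdSimplex ℝ (Fin n)) p

/-- The objective `h(q) + ⟨g, q⟩ - KL(q, p) / (2 lam)` of the proximal mirror ascent step. -/
def mirrorObjective {n : ℕ} (h : (Fin n → ℝ) → ℝ) (lam : ℝ) (g p q : Fin n → ℝ) : EReal :=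
  ((h q + ∑ i, g i * q i : ℝ) : EReal) - ((1 / (2 * lam) : ℝ) : EReal) * klDiv q p

/-- `p'` is a proximal mirror ascent step from `p` with stochastic gradient `g`:
`p' ∈ argmax_{q ∈ Δ} h(q) + ⟨g, q⟩ - KL(q, p) / (2 lam)`. -/
def IsMirrorStep {n : ℕ} (h : (Fin n → ℝ) → ℝ) (lam : ℝ) (g p p' : Fin n → ℝ) : Prop :=
  p' ∈ stdSimplex ℝ (Fin n) ∧ IsMaxOn (mirrorObjective h lam g p) (stdSimplex ℝ (Fin n)) p'

/-- Regularity of the composite objective `Φ(x, p) = f(x, p) + h(p)`: `Φ` is `l`-Lipschitz and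
`L`-smooth in `x` uniformly over the simplex, and `f`, `h` are concave and continuous in `p`. -/
structure IsRegularObjective {d n : ℕ} (f : EuclideanSpace ℝ (Fin d) → (Fin n → ℝ) → ℝ)
    (h : (Fin n → ℝ) → ℝ) (L l : ℝ) : Prop where
  lipschitz : ∀ p ∈ stdSimplex ℝ (Fin n), ∀ x y,
    |(f x p + h p) - (f y p + h p)| ≤ l * ‖x - y‖
  differentiable : ∀ p ∈ stdSimplex ℝ (Fin n), Differentiable ℝ (fun x => f x p + h p)
  smooth : ∀ p ∈ stdSimplex ℝ (Fin n), ∀ x y,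
    ‖gradient (fun z => f z p + h p) x - gradient (fun z => f z p + h p) y‖ ≤ L * ‖x - y‖
  concave_f : ∀ x, ConcaveOn ℝ (stdSimplex ℝ (Fin n)) (f x)
  concave_h : ConcaveOn ℝ (stdSimplex ℝ (Fin n)) h
  continuous_f : ∀ x, ContinuousOn (f x) (stdSimplex ℝ (Fin n))
  continuous_h : ContinuousOn h (stdSimplex ℝ (Fin n))

/-- `(θ, π)` is `T` steps of stochastic gradient descent–proximal mirror ascent with step sizes
`η`, `lam`, stochastic gradients `gθ`, `gπ`, deterministic initial point `(θ₀, π₀)`, adapted to the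
filtration `ℱ`. -/
structure IsRun {d n : ℕ} {Ω : Type*} {mΩ : MeasurableSpace Ω} (μ : Measure Ω)
    (ℱ : Filtration ℕ mΩ) (h : (Fin n → ℝ) → ℝ) (T : ℕ) (η lam : ℝ)
    (θ₀ : EuclideanSpace ℝ (Fin d)) (π₀ : Fin n → ℝ)
    (θ gθ : ℕ → Ω → EuclideanSpace ℝ (Fin d)) (π gπ : ℕ → Ω → Fin n → ℝ) : Prop where
  init_mem : π₀ ∈ stdSimplex ℝ (Fin n)
  init_θ : ∀ ω, θ 0 ω = θ₀
  init_π : ∀ ω, π 0 ω = π₀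
  measurable_θ : ∀ t ≤ T, Measurable[ℱ t] (θ t)
  measurable_π : ∀ t ≤ T, Measurable[ℱ t] (π t)
  step_θ : ∀ t < T, ∀ᵐ ω ∂μ, θ (t + 1) ω = θ t ω - η • gθ t ω
  step_π : ∀ t < T, ∀ᵐ ω ∂μ, IsMirrorStep h lam (gπ t ω) (π t ω) (π (t + 1) ω)

/-- The stochastic gradients of the first `T` steps are square integrable and, given the past,
unbiased for `∇_θ f` and `∇_π f` at the current iterate; `gθ` has variance at most `σ²` and the
sup norm of `gπ` has second moment at most `G²`. -/
structure IsUnbiasedOracle {d n : ℕ} {Ω : Type*} {mΩ : MeasurableSpace Ω} (μ : Measure Ω)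
    (ℱ : Filtration ℕ mΩ) (f : EuclideanSpace ℝ (Fin d) → (Fin n → ℝ) → ℝ) (T : ℕ) (σ G : ℝ)
    (θ gθ : ℕ → Ω → EuclideanSpace ℝ (Fin d)) (π gπ : ℕ → Ω → Fin n → ℝ) : Prop where
  memLp_θ : ∀ t < T, MemLp (gθ t) 2 μ
  memLp_π : ∀ t < T, MemLp (gπ t) 2 μ
  unbiased_θ : ∀ t < T, ∀ᵐ ω ∂μ,
    (μ[gθ t | ℱ t]) ω = gradient (fun x => f x (π t ω)) (θ t ω)
  variance_θ : ∀ t < T, ∫ ω, ‖gθ t ω - (μ[gθ t | ℱ t]) ω‖ ^ 2 ∂μ ≤ σ ^ 2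
  unbiased_π : ∀ t < T, ∀ᵐ ω ∂μ,
    HasSimplexGradientAt (f (θ t ω)) ((μ[gπ t | ℱ t]) ω) (π t ω)
  bound_π : ∀ t < T, ∫ ω, ‖gπ t ω‖ ^ 2 ∂μ ≤ G ^ 2

/-- The constant multiplying `T ^ (-1/4)`. Here `D` is the initial gap of the Moreau envelope. -/
def rateConst (L l σ G R α D : ℝ) : ℝ :=
  2 * D + 4 * L * ((R + 1) / α + G ^ 2 + l * Real.sqrt (l ^ 2 + σ ^ 2))
    + 2 * L * (l ^ 2 + σ ^ 2)

end SaddlePoint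

end

/-
Let `F` be the primal function and `M` its Moreau envelope with parameter `1 / (2 * L)`. As a
maximum of `L`-smooth functions `F` is `L`-weakly convex, so `M` is differentiable and its gradient
at `x` is `2 * L` times the displacement from the proximal point of `x`. Quadratic growth around the
proximal point, compared with the smooth minorant `f(·, π_t) + h(π_t)` of `F`, shows that a step
against `∇_θ f(θ_t, π_t)` decreases `M` by a multiple of `‖∇M(θ_t)‖²`, up to second order terms and
the gap `F(θ_t) - f(θ_t, π_t) - h(π_t)`.

The gap is the regret of mirror ascent against a nearly optimal response to `θ_t`. The response is
frozen on consecutive blocks of `B` steps: within a block it is a fixed comparator, so the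
Kullback–Leibler terms telescope (Pinsker's inequality absorbs the steps) and each block costs one
initial divergence, at most `(R + 1) / α` because the iterates charge every coordinate; freezing
costs `l` times the drift of `θ` within the block. The choice `B ≈ √T` balances the two. The
comparator is a measurable function of an earlier iterate, hence adapted, so all noise terms are
centred.
-/

namespace SaddlePoint

open Finset Filter InnerProductSpace
open scoped Topology Gradient
open InformationTheory (klFun klFun_apply klFun_nonneg klFun_one hasDerivAt_klFun continuous_klFun)

section KullbackLeibler

variable {ι : Type*} [Fintype ι]

/-- Real-valued Kullback–Leibler sum. Unlike `klDiv` it is finite everywhere, so it carries its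
meaning only where `q i = 0 → p i = 0`. -/
noncomputable def klSum (p q : ι → ℝ) : ℝ := ∑ i, p i * Real.log (p i / q i)

-- The difference of the two sides is convex on `[0, ∞)` with a critical point of value `0` at `1`.
lemma three_mul_sub_one_sq_le_mul_klFun {x : ℝ} (hx : 0 ≤ x) :
    3 * (x - 1) ^ 2 ≤ (4 + 2 * x) * klFun x := by
  set ψ : ℝ → ℝ := fun y => (4 + 2 * y) * klFun y - 3 * (y - 1) ^ 2
  set ψ' : ℝ → ℝ := fun y => 2 * klFun y + (4 + 2 * y) * Real.log y - 6 * (y - 1)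
  have hψ : ∀ y, 0 < y → HasDerivAt ψ (ψ' y) y := fun y hy =>
    ((((hasDerivAt_id y).const_mul 2).const_add 4).mul (hasDerivAt_klFun hy.ne')
      |>.sub ((((hasDerivAt_id y).sub_const 1).pow 2).const_mul 3)).congr_deriv
      (by simp only [ψ', id]; ring)
  have hψ' : ∀ y, 0 < y → HasDerivAt ψ' (4 * (Real.log y - (1 - y⁻¹))) y := fun y hy =>
    (((hasDerivAt_klFun hy.ne').const_mul 2).add
      ((((hasDerivAt_id y).const_mul 2).const_add 4).mul (Real.hasDerivAt_log hy.ne'))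
      |>.sub (((hasDerivAt_id y).sub_const 1).const_mul 6)).congr_deriv
      (by simp only [id]; field_simp; ring)
  have hint : ∀ y ∈ interior (Set.Ici (0 : ℝ)), 0 < y := fun y hy => by
    simpa only [interior_Ici, Set.mem_Ioi] using hy
  have hconv : ConvexOn ℝ (Set.Ici 0) ψ :=
    convexOn_of_hasDerivWithinAt2_nonneg (convex_Ici 0)
      (by have := continuous_klFun; fun_prop)
      (fun y hy => (hψ y (hint y hy)).hasDerivWithinAt)
      (fun y hy => (hψ' y (hint y hy)).hasDerivWithinAt)
      (fun y hy => by linarith [Real.one_sub_inv_le_log_of_pos (hint y hy)])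
  have hmin : IsMinOn ψ (Set.Ici 0) 1 :=
    hconv.isMinOn_of_rightDeriv_eq_zero (by simp)
      ((hψ 1 one_pos).hasDerivWithinAt.derivWithin (uniqueDiffWithinAt_Ioi 1) |>.trans
        (by simp [ψ', klFun_one]))
  have h1 : ψ 1 ≤ ψ x := hmin hx
  simp only [ψ, klFun_one, sub_self] at h1
  linarith

lemma mul_log_div_add_sub {a b : ℝ} (hab : b = 0 → a = 0) :
    a * Real.log (a / b) + b - a = b * klFun (a / b) := by
  rcases eq_or_ne b 0 with rfl | hb
  · simp [hab rfl]
  · rw [klFun_apply]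
    field_simp

lemma sum_sub_sum_le_klSum {p q : ι → ℝ} (hp : ∀ i, 0 ≤ p i) (hq : ∀ i, 0 ≤ q i)
    (hpq : ∀ i, q i = 0 → p i = 0) : ∑ i, p i - ∑ i, q i ≤ klSum p q := by
  rw [← sum_sub_distrib]
  refine sum_le_sum fun i _ => ?_
  have := mul_nonneg (hq i) (klFun_nonneg (div_nonneg (hp i) (hq i)))
  linarith [mul_log_div_add_sub (hpq i)]

lemma klSum_nonneg {p q : ι → ℝ} (hp : p ∈ stdSimplex ℝ ι) (hq : q ∈ stdSimplex ℝ ι)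
    (hpq : ∀ i, q i = 0 → p i = 0) : 0 ≤ klSum p q := by
  simpa only [hp.2, hq.2, sub_self] using sum_sub_sum_le_klSum hp.1 hq.1 hpq

-- Pinsker's inequality, by Cauchy–Schwarz with the weights `(4 * q i + 2 * p i) / 3`, of sum `2`.
lemma sq_sum_abs_sub_le_two_mul_klSum {p q : ι → ℝ} (hp : p ∈ stdSimplex ℝ ι)
    (hq : q ∈ stdSimplex ℝ ι) (hpq : ∀ i, q i = 0 → p i = 0) :
    (∑ i, |p i - q i|) ^ 2 ≤ 2 * klSum p q := by
  have hweight : ∑ i, (4 * q i + 2 * p i) / 3 = 2 := by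
    rw [← sum_div, sum_add_distrib, ← mul_sum, ← mul_sum, hp.2, hq.2]
    norm_num
  have hkl : ∑ i, q i * klFun (p i / q i) = klSum p q := by
    simp_rw [← mul_log_div_add_sub (hpq _), sum_sub_distrib, sum_add_distrib, hp.2, hq.2, klSum]
    ring
  rw [← hweight, ← hkl]
  refine sum_sq_le_sum_mul_sum_of_sq_le_mul _
    (fun i _ => by linarith [hp.1 i, hq.1 i])
    (fun i _ => mul_nonneg (hq.1 i)
      (klFun_nonneg (div_nonneg (hp.1 i) (hq.1 i)))) fun i _ => ?_
  rw [sq_abs]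
  rcases eq_or_ne (q i) 0 with h0 | h0
  · simp [h0, hpq i h0]
  · have hscalar := three_mul_sub_one_sq_le_mul_klFun (div_nonneg (hp.1 i) (hq.1 i))
    calc (p i - q i) ^ 2
        = q i ^ 2 * (3 * (p i / q i - 1) ^ 2) / 3 := by field_simp
      _ ≤ q i ^ 2 * ((4 + 2 * (p i / q i)) * klFun (p i / q i)) / 3 := by gcongr
      _ = (4 * q i + 2 * p i) / 3 * (q i * klFun (p i / q i)) := by
        field_simp

lemma dotProduct_le_norm_mul_sum_abs (g v : ι → ℝ) : g ⬝ᵥ v ≤ ‖g‖ * ∑ i, |v i| := by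
  rw [mul_sum]
  refine sum_le_sum fun i _ => ?_
  calc g i * v i ≤ ‖g i‖ * |v i| := (le_abs_self _).trans_eq (abs_mul _ _)
    _ ≤ ‖g‖ * |v i| := by gcongr; exact norm_le_pi_norm g i

lemma dotProduct_sub_le_add_klSum {p q : ι → ℝ} (hp : p ∈ stdSimplex ℝ ι)
    (hq : q ∈ stdSimplex ℝ ι) (hpq : ∀ i, q i = 0 → p i = 0) (g : ι → ℝ) {lam : ℝ}
    (hlam : 0 < lam) : g ⬝ᵥ (p - q) ≤ lam * ‖g‖ ^ 2 + 1 / (2 * lam) * klSum p q := by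
  set s := ∑ i, |p i - q i|
  calc g ⬝ᵥ (p - q) ≤ ‖g‖ * s := dotProduct_le_norm_mul_sum_abs g (p - q)
    _ = lam * ‖g‖ ^ 2 + s ^ 2 / (4 * lam) - (2 * lam * ‖g‖ - s) ^ 2 / (4 * lam) := by
      field_simp; ring
    _ ≤ lam * ‖g‖ ^ 2 + s ^ 2 / (4 * lam) := sub_le_self _ (by positivity)
    _ = lam * ‖g‖ ^ 2 + 1 / (2 * lam) * (s ^ 2 / 2) := by ring
    _ ≤ lam * ‖g‖ ^ 2 + 1 / (2 * lam) * klSum p q := by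
      gcongr
      linarith [sq_sum_abs_sub_le_two_mul_klSum hp hq hpq]

lemma klSum_sub_klSum {p r z : ι → ℝ} (hr : ∀ i, r i = 0 → p i = 0)
    (hz : ∀ i, z i = 0 → p i = 0) :
    klSum p r - klSum p z = ∑ i, p i * (Real.log (z i) - Real.log (r i)) := by
  rw [klSum, klSum, ← sum_sub_distrib]
  refine sum_congr rfl fun i _ => ?_
  rcases eq_or_ne (p i) 0 with h0 | h0
  · simp [h0]
  · rw [Real.log_div h0 (mt (hr i) h0), Real.log_div h0 (mt (hz i) h0)]
    ring

lemma klSum_smul_add_smul {p q r : ι → ℝ} (hp : ∀ i, 0 ≤ p i) (hq : ∀ i, 0 ≤ q i)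
    (hpr : ∀ i, r i = 0 → p i = 0) (hqr : ∀ i, r i = 0 → q i = 0) {a b : ℝ} (ha : 0 < a)
    (hb : 0 < b) :
    klSum (a • p + b • q) r + a * klSum p (a • p + b • q) + b * klSum q (a • p + b • q)
      = a * klSum p r + b * klSum q r := by
  set z := a • p + b • q
  have hz : ∀ i, z i = a * p i + b * q i := fun i => rfl
  have hpz : ∀ i, z i = 0 → p i = 0 := fun i hi => by
    nlinarith [hz i, mul_nonneg ha.le (hp i), mul_nonneg hb.le (hq i)]
  have hqz : ∀ i, z i = 0 → q i = 0 := fun i hi => by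
    nlinarith [hz i, mul_nonneg ha.le (hp i), mul_nonneg hb.le (hq i)]
  have hzr : ∀ i, r i = 0 → z i = 0 := fun i hi => by rw [hz, hpr i hi, hqr i hi]; ring
  have hself : klSum z z = 0 := by
    refine sum_eq_zero fun i _ => ?_
    rcases eq_or_ne (z i) 0 with h0 | h0 <;> simp [h0]
  have hsplit : klSum z r - klSum z z
      = a * (klSum p r - klSum p z) + b * (klSum q r - klSum q z) := by
    rw [klSum_sub_klSum hzr fun _ => id, klSum_sub_klSum hpr hpz,
      klSum_sub_klSum hqr hqz, mul_sum, mul_sum, ← sum_add_distrib]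
    exact sum_congr rfl fun i _ => by rw [hz]; ring
  linarith

-- Replacing `q i` by `1` raises the total mass of `q` to at most `2`.
lemma mul_neg_log_le_klSum_add_one {p q : ι → ℝ} (hp : p ∈ stdSimplex ℝ ι)
    (hq : q ∈ stdSimplex ℝ ι) (hpq : ∀ i, q i = 0 → p i = 0) (i : ι) :
    p i * -Real.log (q i) ≤ klSum p q + 1 := by
  classical
  set z := Function.update q i 1 with hz
  have hzi : z i = 1 := Function.update_self ..
  have hzj : ∀ j ≠ i, z j = q j := fun j hj => Function.update_of_ne hj ..
  have hz0 : ∀ j, 0 ≤ z j := fun j => by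
    rcases eq_or_ne j i with rfl | hj
    · simp [hzi]
    · simpa [hzj j hj] using hq.1 j
  have hpz : ∀ j, z j = 0 → p j = 0 := fun j => by
    rcases eq_or_ne j i with rfl | hj
    · simp [hzi]
    · simpa [hzj j hj] using hpq j
  have hmass : ∑ j, z j = 2 - q i := by
    have hsplit := sum_sdiff (f := q) (subset_univ {i})
    rw [sum_singleton, hq.2] at hsplit
    rw [hz, sum_update_of_mem (mem_univ i)]
    linarith
  have hdiff : klSum p q - klSum p z = p i * -Real.log (q i) := by
    rw [klSum_sub_klSum hpq hpz, sum_eq_single i (fun j _ hj => by simp [hzj j hj]) (by simp),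
      hzi, Real.log_one, zero_sub]
  linarith [sum_sub_sum_le_klSum hp.1 hz0 hpz, hp.2, hq.1 i]

lemma klSum_le_add_one_div {p q r : ι → ℝ} {α : ℝ} (hp : p ∈ stdSimplex ℝ ι)
    (hq : q ∈ stdSimplex ℝ ι) (hr : r ∈ stdSimplex ℝ ι) (hpq : ∀ i, q i = 0 → p i = 0)
    (hα : 0 < α) (hαp : ∀ i, α ≤ p i) : klSum r q ≤ (klSum p q + 1) / α := by
  have hlog_nonpos : ∀ {s : ι → ℝ}, s ∈ stdSimplex ℝ ι → ∀ i, Real.log (s i) ≤ 0 := fun hs i =>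
    Real.log_nonpos (hs.1 i) (mem_Icc_of_mem_stdSimplex hs i).2
  have hq_ne : ∀ i, q i ≠ 0 := fun i h0 => (hα.trans_le (hαp i)).ne' (hpq i h0)
  have hlog_q : ∀ i, -Real.log (q i) ≤ (klSum p q + 1) / α := fun i => by
    rw [le_div_iff₀' hα]
    calc α * -Real.log (q i) ≤ p i * -Real.log (q i) :=
          mul_le_mul_of_nonneg_right (hαp i) (neg_nonneg.2 (hlog_nonpos hq i))
      _ ≤ klSum p q + 1 := mul_neg_log_le_klSum_add_one hp hq hpq i
  calc klSum r q ≤ ∑ i, r i * ((klSum p q + 1) / α) := by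
        refine sum_le_sum fun i _ => ?_
        rcases eq_or_ne (r i) 0 with h0 | h0
        · simp [h0]
        · refine mul_le_mul_of_nonneg_left ?_ (hr.1 i)
          rw [Real.log_div h0 (hq_ne i)]
          linarith [hlog_q i, hlog_nonpos hr i]
    _ = (klSum p q + 1) / α := by rw [← sum_mul, hr.2, one_mul]

end KullbackLeibler

section MirrorStep

variable {n : ℕ} {h : (Fin n → ℝ) → ℝ} {lam : ℝ} {g p p' q : Fin n → ℝ}

lemma klDiv_eq_klSum (hpq : ∀ i, q i = 0 → p i = 0) : klDiv p q = (klSum p q : EReal) :=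
  if_pos hpq

lemma klDiv_le_coe_iff {R : ℝ} :
    klDiv p q ≤ (R : EReal) ↔ (∀ i, q i = 0 → p i = 0) ∧ klSum p q ≤ R := by
  by_cases hpq : ∀ i, q i = 0 → p i = 0
  · rw [klDiv_eq_klSum hpq, EReal.coe_le_coe_iff, and_iff_right hpq]
  · simp [klDiv, hpq]

lemma IsMirrorStep.objective_le (hs : IsMirrorStep h lam g p p') (hp : ∀ i, 0 < p i)
    (hq : q ∈ stdSimplex ℝ (Fin n)) :
    h q + g ⬝ᵥ q - 1 / (2 * lam) * klSum q p ≤ h p' + g ⬝ᵥ p' - 1 / (2 * lam) * klSum p' p := by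
  have hac : ∀ r : Fin n → ℝ, ∀ i, p i = 0 → r i = 0 := fun r i hi => absurd hi (hp i).ne'
  have hmax := hs.2 hq
  simp only [Set.mem_ofPred_eq, mirrorObjective, klDiv_eq_klSum (hac _)] at hmax
  exact_mod_cast hmax

-- Optimality of `p'` against the point `z` of the segment from `p'` to `q`, divided by `e`: the
-- divergence `klSum q z` is what strong convexity of the entropy leaves over.
lemma IsMirrorStep.add_klSum_le (hh : ConcaveOn ℝ (stdSimplex ℝ (Fin n)) h)
    (hlam : 0 < lam) (hs : IsMirrorStep h lam g p p') (hp : ∀ i, 0 < p i)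
    (hq : q ∈ stdSimplex ℝ (Fin n)) {e : ℝ} (he : 0 < e) (he1 : e < 1) :
    h q - h p' + g ⬝ᵥ (q - p') + 1 / (2 * lam) * klSum q ((1 - e) • p' + e • q)
      ≤ 1 / (2 * lam) * (klSum q p - klSum p' p) := by
  have h1e : 0 < 1 - e := sub_pos.2 he1
  set z := (1 - e) • p' + e • q with hz_def
  have hz : z ∈ stdSimplex ℝ (Fin n) :=
    convex_stdSimplex ℝ _ hs.1 hq h1e.le he.le (sub_add_cancel 1 e)
  have hac : ∀ r : Fin n → ℝ, ∀ i, p i = 0 → r i = 0 := fun r i hi => absurd hi (hp i).ne'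
  have hopt := hs.objective_le hp hz
  have hconc : (1 - e) * h p' + e * h q ≤ h z :=
    hh.2 hs.1 hq h1e.le he.le (sub_add_cancel 1 e)
  have hcomp := klSum_smul_add_smul hs.1.1 hq.1 (hac p') (hac q) h1e he
  have hnonneg : 0 ≤ klSum p' z := klSum_nonneg hs.1 hz fun i hi => by
    have hzi : (1 - e) * p' i + e * q i = 0 := hi
    nlinarith [mul_nonneg h1e.le (hs.1.1 i), mul_nonneg he.le (hq.1 i)]
  have hdot : g ⬝ᵥ z = g ⬝ᵥ p' + e * g ⬝ᵥ (q - p') := by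
    simp only [hz_def, dotProduct_add, dotProduct_smul, dotProduct_sub, smul_eq_mul]
    ring
  have hgap : 0 ≤ 1 / (2 * lam) * ((1 - e) * klSum p' z) := by positivity
  refine le_of_mul_le_mul_left ?_ he
  rw [← hz_def] at hcomp
  linear_combination hopt + hconc + hgap + 1 / (2 * lam) * hcomp - hdot

-- Near a vanishing coordinate of `p'` the divergence `klSum p z` would blow up as `z → p'`.
lemma IsMirrorStep.pos (hh : ConcaveOn ℝ (stdSimplex ℝ (Fin n)) h) (hlam : 0 < lam)
    (hs : IsMirrorStep h lam g p p') (hpm : p ∈ stdSimplex ℝ (Fin n)) (hp : ∀ i, 0 < p i)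
    (i : Fin n) : 0 < p' i := by
  by_contra! hi
  have hi0 : p' i = 0 := le_antisymm hi (hs.1.1 i)
  set K := klSum p p - klSum p' p - 2 * lam * (h p - h p' + g ⬝ᵥ (p - p')) + 1 with hK
  have hbound : ∀ e : ℝ, 0 < e → e < 1 → p i * -Real.log (e * p i) ≤ K := by
    intro e he he1
    have hz : (1 - e) • p' + e • p ∈ stdSimplex ℝ (Fin n) :=
      convex_stdSimplex ℝ _ hs.1 hpm (sub_pos.2 he1).le he.le (sub_add_cancel 1 e)
    have hstep := hs.add_klSum_le hh hlam hp hpm he he1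
    have hlog := mul_neg_log_le_klSum_add_one hpm hz (fun j hj => by
      have hzj : (1 - e) * p' j + e * p j = 0 := hj
      nlinarith [mul_nonneg (sub_pos.2 he1).le (hs.1.1 j), mul_pos he (hp j)]) i
    have hzi : ((1 - e) • p' + e • p) i = e * p i := by simp [hi0]
    rw [hzi] at hlog
    field_simp at hstep
    linarith [hK]
  have hblowup : Tendsto (fun e : ℝ => p i * -Real.log (e * p i)) (𝓝[>] 0) atTop := by
    refine (tendsto_neg_atBot_atTop.comp (Real.tendsto_log_nhdsGT_zero.comp ?_)).const_mul_atTop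
      (hp i)
    refine tendsto_nhdsWithin_iff.2 ⟨?_, eventually_mem_nhdsWithin.mono fun e he =>
      mul_pos he (hp i)⟩
    exact ((continuous_mul_const (p i)).tendsto' 0 0 (zero_mul _)).mono_left nhdsWithin_le_nhds
  obtain ⟨e, hlt, he⟩ :=
    ((hblowup.eventually_gt_atTop K).and (Ioo_mem_nhdsGT one_pos)).exists
  exact hlt.not_ge (hbound e he.1 he.2)

lemma continuousAt_klSum_right (hq : ∀ i, 0 < q i) :
    ContinuousAt (fun z => klSum p z) q := by
  refine tendsto_finsetSum _ fun i _ => ?_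
  rcases eq_or_ne (p i) 0 with h0 | h0
  · simp [h0]
  · have hi : ContinuousAt (fun z : Fin n → ℝ => p i / z i) q :=
      continuousAt_const.div (continuousAt_apply i q) (hq i).ne'
    exact (hi.log (div_ne_zero h0 (hq i).ne')).tendsto.const_mul (p i)

lemma IsMirrorStep.regret_le (hh : ConcaveOn ℝ (stdSimplex ℝ (Fin n)) h) (hlam : 0 < lam)
    (hs : IsMirrorStep h lam g p p') (hpm : p ∈ stdSimplex ℝ (Fin n)) (hp : ∀ i, 0 < p i)
    (hq : q ∈ stdSimplex ℝ (Fin n)) :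
    h q - h p' + g ⬝ᵥ (q - p)
      ≤ 1 / (2 * lam) * (klSum q p - klSum q p') + lam * ‖g‖ ^ 2 := by
  have hthree : h q - h p' + g ⬝ᵥ (q - p') + 1 / (2 * lam) * klSum q p'
      ≤ 1 / (2 * lam) * (klSum q p - klSum p' p) := by
    have hz : Tendsto (fun e : ℝ => (1 - e) • p' + e • q) (𝓝[>] 0) (𝓝 p') :=
      (Continuous.tendsto' (by fun_prop) 0 p' (by simp)).mono_left nhdsWithin_le_nhds
    have hlim := (((continuousAt_klSum_right (p := q) (hs.pos hh hlam hpm hp)).tendsto.comp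
      hz).const_mul (1 / (2 * lam))).const_add (h q - h p' + g ⬝ᵥ (q - p'))
    refine le_of_tendsto hlim ?_
    filter_upwards [Ioo_mem_nhdsGT one_pos] with e he
    exact hs.add_klSum_le hh hlam hp hq he.1 he.2
  have hpinsker := dotProduct_sub_le_add_klSum hs.1 hpm (fun i hi => absurd hi (hp i).ne') g hlam
  have hsplit : g ⬝ᵥ (q - p) = g ⬝ᵥ (q - p') + g ⬝ᵥ (p' - p) := by
    rw [← dotProduct_add, sub_add_sub_cancel]
  linarith

end MirrorStep

section StrongConvexity

variable {E : Type*} [NormedAddCommGroup E] [NormedSpace ℝ E] {φ : E → ℝ} {m : ℝ}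

lemma strongConvexOn_univ_of_exists_subgradient
    (hφ : ∀ z, ∃ ℓ : E →ₗ[ℝ] ℝ, ∀ y, φ z + ℓ (y - z) + m / 2 * ‖y - z‖ ^ 2 ≤ φ y) :
    StrongConvexOn Set.univ m φ := by
  refine ⟨convex_univ, fun x _ y _ a b ha hb hab => ?_⟩
  obtain ⟨ℓ, hℓ⟩ := hφ (a • x + b • y)
  have hx : x - (a • x + b • y) = b • (x - y) := by
    rw [← eq_sub_iff_add_eq'] at hab; rw [hab]; module
  have hy : y - (a • x + b • y) = -(a • (x - y)) := by
    rw [← eq_sub_iff_add_eq] at hab; rw [hab]; module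
  have hlower_x := mul_le_mul_of_nonneg_left (hℓ x) ha
  have hlower_y := mul_le_mul_of_nonneg_left (hℓ y) hb
  rw [hx, map_smul, norm_smul, Real.norm_of_nonneg hb] at hlower_x
  rw [hy, map_neg, map_smul, norm_neg, norm_smul, Real.norm_of_nonneg ha] at hlower_y
  simp only [smul_eq_mul] at *
  obtain rfl : b = 1 - a := by linarith
  linear_combination hlower_x + hlower_y

lemma add_half_mul_norm_sub_sq_le_of_isMinOn {s : Set E} (hφ : StrongConvexOn s m φ) {x y : E}
    (hx : x ∈ s) (hmin : IsMinOn φ s x) (hy : y ∈ s) :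
    φ x + m / 2 * ‖y - x‖ ^ 2 ≤ φ y := by
  have hlim : Tendsto (fun e : ℝ => φ x + (1 - e) * (m / 2 * ‖y - x‖ ^ 2)) (𝓝[>] 0)
      (𝓝 (φ x + m / 2 * ‖y - x‖ ^ 2)) :=
    (Continuous.tendsto' (by fun_prop) 0 _ (by simp)).mono_left nhdsWithin_le_nhds
  refine le_of_tendsto hlim ?_
  filter_upwards [Ioo_mem_nhdsGT one_pos] with e he
  have h1e : 0 ≤ 1 - e := (sub_pos.2 he.2).le
  have hconv := hφ.2 hy hx he.1.le h1e (add_sub_cancel e 1)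
  have hle : φ x ≤ φ (e • y + (1 - e) • x) :=
    hmin (hφ.1 hy hx he.1.le h1e (add_sub_cancel e 1))
  simp only [smul_eq_mul] at hconv
  refine le_of_mul_le_mul_left ?_ he.1
  linear_combination hle + hconv

end StrongConvexity

section Smooth

variable {E : Type*} [NormedAddCommGroup E] [InnerProductSpace ℝ E]

lemma strongConvexOn_const_mul_norm_sub_sq (c : ℝ) (x : E) :
    StrongConvexOn Set.univ (2 * c) (fun y => c * ‖y - x‖ ^ 2) := by
  refine strongConvexOn_univ_of_exists_subgradient fun z =>
    ⟨(2 * c) • innerₛₗ ℝ (z - x), fun y => le_of_eq ?_⟩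
  rw [← sub_add_sub_cancel y z x, norm_add_sq_real, real_inner_comm]
  simp only [LinearMap.smul_apply, innerₛₗ_apply_apply, smul_eq_mul]
  ring

variable [CompleteSpace E]

lemma add_inner_gradient_sub_le {φ : E → ℝ} {L : ℝ} (hd : Differentiable ℝ φ) {x : E}
    (hs : ∀ z, ‖∇ φ z - ∇ φ x‖ ≤ L * ‖z - x‖) (y : E) :
    φ x + ⟪∇ φ x, y - x⟫_ℝ - L / 2 * ‖y - x‖ ^ 2 ≤ φ y := by
  set ψ : ℝ → ℝ := fun s => φ (x + s • (y - x)) - s * ⟪∇ φ x, y - x⟫_ℝ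
    + L / 2 * ‖y - x‖ ^ 2 * s ^ 2 with hψ
  have hder : ∀ s, HasDerivAt ψ (⟪∇ φ (x + s • (y - x)) - ∇ φ x, y - x⟫_ℝ
      + L * ‖y - x‖ ^ 2 * s) s := fun s => by
    have hline : HasDerivAt (fun s : ℝ => x + s • (y - x)) (y - x) s := by
      simpa only [one_smul, id] using ((hasDerivAt_id s).smul_const (y - x)).const_add x
    have hcomp := (hd (x + s • (y - x))).hasGradientAt.hasFDerivAt.comp_hasDerivAt s hline
    refine ((hcomp.sub ((hasDerivAt_id s).mul_const ⟪∇ φ x, y - x⟫_ℝ)).add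
      ((hasDerivAt_pow 2 s).const_mul (L / 2 * ‖y - x‖ ^ 2))).congr_deriv ?_
    simp only [toDual_apply_apply, inner_sub_left]
    push_cast
    ring
  have hder_nonneg : ∀ s ∈ interior (Set.Icc (0 : ℝ) 1),
      0 ≤ ⟪∇ φ (x + s • (y - x)) - ∇ φ x, y - x⟫_ℝ + L * ‖y - x‖ ^ 2 * s := fun s hs01 => by
    rw [interior_Icc] at hs01
    have hlip := hs (x + s • (y - x))
    rw [add_sub_cancel_left, norm_smul, Real.norm_of_nonneg hs01.1.le] at hlip
    have hinner := neg_le_of_abs_le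
      (abs_real_inner_le_norm (∇ φ (x + s • (y - x)) - ∇ φ x) (y - x))
    linarith [mul_le_mul_of_nonneg_right hlip (norm_nonneg (y - x))]
  have hmono : MonotoneOn ψ (Set.Icc 0 1) :=
    monotoneOn_of_hasDerivWithinAt_nonneg (convex_Icc 0 1)
      (fun s _ => (hder s).continuousAt.continuousWithinAt)
      (fun s _ => (hder s).hasDerivWithinAt) hder_nonneg
  have hendpoints := hmono ⟨le_rfl, zero_le_one⟩ ⟨zero_le_one, le_rfl⟩ zero_le_one
  simp only [hψ, zero_smul, one_smul, add_zero, add_sub_cancel] at hendpoints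
  linarith

lemma norm_gradient_le_of_abs_sub_le {φ : E → ℝ} {l : ℝ} (hl : 0 ≤ l)
    (hφ : ∀ x y, |φ x - φ y| ≤ l * ‖x - y‖) (x : E) : ‖∇ φ x‖ ≤ l := by
  rw [gradient, LinearIsometryEquiv.norm_map]
  exact norm_fderiv_le_of_lip' ℝ hl (Eventually.of_forall fun y => hφ y x)

lemma hasGradientAt_of_abs_sub_le_sq {φ : E → ℝ} {v x : E} {c : ℝ}
    (h : ∀ y, |φ y - φ x - ⟪v, y - x⟫_ℝ| ≤ c * ‖y - x‖ ^ 2) : HasGradientAt φ v x := by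
  rw [hasGradientAt_iff_isLittleO]
  have hbigO : (fun y => φ y - φ x - ⟪v, y - x⟫_ℝ) =O[𝓝 x] fun y => ‖y - x‖ ^ 2 :=
    Asymptotics.IsBigO.of_bound c (Eventually.of_forall fun y => by
      simpa only [Real.norm_eq_abs, norm_pow, abs_norm] using h y)
  exact hbigO.trans_isLittleO <|
    (Asymptotics.isLittleO_norm_pow_id one_lt_two).comp_tendsto
      (tendsto_sub_nhds_zero_iff.2 tendsto_id)

end Smooth

section Moreau

/-- `w` is a proximal point of `F` at `x` with parameter `ρ`: it attains the minimum that defines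
the Moreau envelope at `x`. -/
def IsProxPoint {E : Type*} [NormedAddCommGroup E] (F : E → ℝ) (ρ : ℝ) (x w : E) : Prop :=
  IsMinOn (fun y => F y + 1 / (2 * ρ) * ‖y - x‖ ^ 2) Set.univ w

lemma exists_isProxPoint {E : Type*} [NormedAddCommGroup E] [ProperSpace E] {F : E → ℝ} {ρ : ℝ}
    (hρ : 0 < ρ) (hF : Continuous F) (hb : BddBelow (Set.range F)) (x : E) :
    ∃ w, IsProxPoint F ρ x w := by
  obtain ⟨c, hc⟩ := hb
  have hcoercive : Tendsto (fun y => c + 1 / (2 * ρ) * ‖y - x‖ ^ 2) (cocompact E) atTop := by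
    simp_rw [← dist_eq_norm]
    exact tendsto_atTop_add_const_left _ c <|
      ((tendsto_pow_atTop two_ne_zero).comp (tendsto_dist_right_cocompact_atTop x)).const_mul_atTop
        (by positivity)
  obtain ⟨w, hw⟩ := (show Continuous fun y => F y + 1 / (2 * ρ) * ‖y - x‖ ^ 2 by fun_prop)
    |>.exists_forall_le (tendsto_atTop_mono
      (fun y => by gcongr; exact hc (Set.mem_range_self y)) hcoercive)
  exact ⟨w, fun y _ => hw y⟩

lemma IsProxPoint.growth {E : Type*} [NormedAddCommGroup E] [InnerProductSpace ℝ E] {F : E → ℝ}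
    {ρ m : ℝ} {x w : E} (hw : IsProxPoint F ρ x w) (hF : StrongConvexOn Set.univ (-m) F) (y : E) :
    F w + 1 / (2 * ρ) * ‖w - x‖ ^ 2 + (1 / ρ - m) / 2 * ‖y - w‖ ^ 2
      ≤ F y + 1 / (2 * ρ) * ‖y - x‖ ^ 2 := by
  have hconv : StrongConvexOn Set.univ (1 / ρ - m)
      (fun y => F y + 1 / (2 * ρ) * ‖y - x‖ ^ 2) := by
    refine (hF.add (strongConvexOn_const_mul_norm_sub_sq (1 / (2 * ρ)) x)).mono fun r => le_of_eq ?_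
    simp only [Pi.add_apply]
    ring
  exact add_half_mul_norm_sub_sq_le_of_isMinOn hconv (Set.mem_univ w) hw (Set.mem_univ y)

variable {d : ℕ} {F : EuclideanSpace ℝ (Fin d) → ℝ} {ρ m : ℝ} {x w : EuclideanSpace ℝ (Fin d)}

lemma moreauEnvelope_le (hρ : 0 ≤ ρ) (hb : BddBelow (Set.range F))
    (x w : EuclideanSpace ℝ (Fin d)) :
    moreauEnvelope F ρ x ≤ F w + 1 / (2 * ρ) * ‖w - x‖ ^ 2 := by
  obtain ⟨c, hc⟩ := hb
  refine ciInf_le ⟨c, Set.forall_mem_range.2 fun y => ?_⟩ w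
  exact le_add_of_le_of_nonneg (hc (Set.mem_range_self y)) (by positivity)

lemma le_moreauEnvelope (hρ : 0 ≤ ρ) {c : ℝ} (hc : ∀ y, c ≤ F y)
    (x : EuclideanSpace ℝ (Fin d)) : c ≤ moreauEnvelope F ρ x :=
  le_ciInf fun y => le_add_of_le_of_nonneg (hc y) (by positivity)

lemma bddBelow_range_moreauEnvelope (hρ : 0 ≤ ρ) (hb : BddBelow (Set.range F)) :
    BddBelow (Set.range (moreauEnvelope F ρ)) := by
  obtain ⟨c, hc⟩ := hb
  exact ⟨c, Set.forall_mem_range.2 (le_moreauEnvelope hρ (Set.forall_mem_range.1 hc))⟩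

lemma abs_moreauEnvelope_sub_le (hρ : 0 ≤ ρ) (hb : BddBelow (Set.range F)) {l : ℝ}
    (hF : ∀ x y, |F x - F y| ≤ l * ‖x - y‖) (x y : EuclideanSpace ℝ (Fin d)) :
    |moreauEnvelope F ρ x - moreauEnvelope F ρ y| ≤ l * ‖x - y‖ := by
  have hle : ∀ x y, moreauEnvelope F ρ x - l * ‖x - y‖ ≤ moreauEnvelope F ρ y := fun x y => by
    refine le_ciInf fun w => ?_
    have hshift := moreauEnvelope_le hρ hb x (w + (x - y))
    have hlip := (abs_le.1 (hF (w + (x - y)) w)).2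
    rw [show w + (x - y) - x = w - y by abel] at hshift
    rw [add_sub_cancel_left] at hlip
    linarith
  rw [abs_sub_le_iff]
  exact ⟨by linarith [hle x y], by rw [norm_sub_rev]; linarith [hle y x]⟩

lemma IsProxPoint.moreauEnvelope_eq (hw : IsProxPoint F ρ x w) :
    moreauEnvelope F ρ x = F w + 1 / (2 * ρ) * ‖w - x‖ ^ 2 :=
  le_antisymm (ciInf_le ⟨_, Set.forall_mem_range.2 fun y => hw (Set.mem_univ y)⟩ w)
    (le_ciInf fun y => hw (Set.mem_univ y))

lemma IsProxPoint.moreauEnvelope_le_add_inner (hw : IsProxPoint F ρ x w) (hρ : 0 < ρ)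
    (hb : BddBelow (Set.range F)) (y : EuclideanSpace ℝ (Fin d)) :
    moreauEnvelope F ρ y ≤ moreauEnvelope F ρ x + ⟪ρ⁻¹ • (x - w), y - x⟫_ℝ
      + 1 / (2 * ρ) * ‖y - x‖ ^ 2 := by
  refine (moreauEnvelope_le hρ.le hb y w).trans_eq ?_
  rw [hw.moreauEnvelope_eq, ← sub_sub_sub_cancel_right w y x, norm_sub_sq_real,
    real_inner_smul_left, ← neg_sub x w, inner_neg_left]
  field_simp
  ring

lemma IsProxPoint.add_inner_le_moreauEnvelope (hw : IsProxPoint F ρ x w) (hρ : 0 < ρ)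
    (hρm : ρ * m < 1) (hF : StrongConvexOn Set.univ (-m) F) {y v : EuclideanSpace ℝ (Fin d)}
    (hv : IsProxPoint F ρ y v) :
    moreauEnvelope F ρ x + ⟪ρ⁻¹ • (x - w), y - x⟫_ℝ - m / (2 * (1 - ρ * m)) * ‖y - x‖ ^ 2
      ≤ moreauEnvelope F ρ y := by
  have hκ : 0 < 1 - ρ * m := by linarith
  have hsquare : 0 ≤ (1 - ρ * m) / (2 * ρ) * ‖v - w‖ ^ 2 - ρ⁻¹ * ⟪v - w, y - x⟫_ℝ
      + 1 / (2 * ρ * (1 - ρ * m)) * ‖y - x‖ ^ 2 := by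
    have hnonneg : 0 ≤ 1 / (2 * ρ * (1 - ρ * m)) * ‖(1 - ρ * m) • (v - w) - (y - x)‖ ^ 2 := by
      positivity
    rw [norm_sub_sq_real, norm_smul, mul_pow, Real.norm_eq_abs, sq_abs,
      real_inner_smul_left] at hnonneg
    refine hnonneg.trans_eq ?_
    field_simp
  have hgrowth := hw.growth hF v
  have hcurvature : (1 / ρ - m) / 2 = (1 - ρ * m) / (2 * ρ) := by field_simp
  have hmodulus : m / (2 * (1 - ρ * m)) = 1 / (2 * ρ * (1 - ρ * m)) - 1 / (2 * ρ) := by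
    rw [div_sub_div _ _ (by positivity) (by positivity), div_eq_div_iff (by positivity)
      (by positivity)]
    ring
  have hshift : 1 / (2 * ρ) * ‖v - y‖ ^ 2 = 1 / (2 * ρ) * ‖v - x‖ ^ 2 - ρ⁻¹ * ⟪v - w, y - x⟫_ℝ
      + ρ⁻¹ * ⟪x - w, y - x⟫_ℝ + 1 / (2 * ρ) * ‖y - x‖ ^ 2 := by
    rw [← sub_sub_sub_cancel_right v y x, norm_sub_sq_real, ← sub_sub_sub_cancel_right v x w,
      inner_sub_left]
    field_simp
    ring
  rw [hw.moreauEnvelope_eq, hv.moreauEnvelope_eq, real_inner_smul_left, hmodulus, hshift]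
  rw [hcurvature] at hgrowth
  linarith

lemma IsProxPoint.hasGradientAt_moreauEnvelope (hw : IsProxPoint F ρ x w) (hρ : 0 < ρ)
    (hρm : ρ * m < 1) (hF : StrongConvexOn Set.univ (-m) F) (hc : Continuous F)
    (hb : BddBelow (Set.range F)) : HasGradientAt (moreauEnvelope F ρ) (ρ⁻¹ • (x - w)) x := by
  refine hasGradientAt_of_abs_sub_le_sq
    (c := max (1 / (2 * ρ)) (m / (2 * (1 - ρ * m)))) fun y => ?_
  obtain ⟨v, hv⟩ := exists_isProxPoint hρ hc hb y
  have hupper := hw.moreauEnvelope_le_add_inner hρ hb y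
  have hlower := hw.add_inner_le_moreauEnvelope hρ hρm hF hv
  have hmax_left := mul_le_mul_of_nonneg_right
    (le_max_left (1 / (2 * ρ)) (m / (2 * (1 - ρ * m)))) (sq_nonneg ‖y - x‖)
  have hmax_right := mul_le_mul_of_nonneg_right
    (le_max_right (1 / (2 * ρ)) (m / (2 * (1 - ρ * m)))) (sq_nonneg ‖y - x‖)
  exact abs_le.2 ⟨by linarith, by linarith⟩

lemma differentiable_moreauEnvelope (hρ : 0 < ρ) (hρm : ρ * m < 1)
    (hF : StrongConvexOn Set.univ (-m) F) (hc : Continuous F) (hb : BddBelow (Set.range F)) :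
    Differentiable ℝ (moreauEnvelope F ρ) := fun x => by
  obtain ⟨w, hw⟩ := exists_isProxPoint hρ hc hb x
  exact (hw.hasGradientAt_moreauEnvelope hρ hρm hF hc hb).differentiableAt

lemma moreauEnvelope_le_add_inner_gradient (hρ : 0 < ρ) (hρm : ρ * m < 1)
    (hF : StrongConvexOn Set.univ (-m) F) (hc : Continuous F) (hb : BddBelow (Set.range F))
    (x y : EuclideanSpace ℝ (Fin d)) :
    moreauEnvelope F ρ y ≤ moreauEnvelope F ρ x + ⟪∇ (moreauEnvelope F ρ) x, y - x⟫_ℝ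
      + 1 / (2 * ρ) * ‖y - x‖ ^ 2 := by
  obtain ⟨w, hw⟩ := exists_isProxPoint hρ hc hb x
  rw [(hw.hasGradientAt_moreauEnvelope hρ hρm hF hc hb).gradient]
  exact hw.moreauEnvelope_le_add_inner hρ hb y

-- The gap `F x - φ x` is what the minorant loses against the quadratic growth of the proximal
-- objective, evaluated at the proximal point.
lemma norm_sq_gradient_moreauEnvelope_le (hρ : 0 < ρ) (hρm : ρ * m < 1)
    (hF : StrongConvexOn Set.univ (-m) F) (hc : Continuous F) (hb : BddBelow (Set.range F))
    {φ : EuclideanSpace ℝ (Fin d) → ℝ} (hd : Differentiable ℝ φ) {x : EuclideanSpace ℝ (Fin d)}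
    (hs : ∀ z, ‖∇ φ z - ∇ φ x‖ ≤ m * ‖z - x‖) (hφ : ∀ z, φ z ≤ F z) :
    ρ * (1 - ρ * m) * ‖∇ (moreauEnvelope F ρ) x‖ ^ 2
      ≤ F x - φ x + ρ * ⟪∇ (moreauEnvelope F ρ) x, ∇ φ x⟫_ℝ := by
  obtain ⟨w, hw⟩ := exists_isProxPoint hρ hc hb x
  have hgrad : ρ • ∇ (moreauEnvelope F ρ) x = x - w := by
    rw [(hw.hasGradientAt_moreauEnvelope hρ hρm hF hc hb).gradient, smul_inv_smul₀ hρ.ne']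
  have hnorm : ‖x - w‖ ^ 2 = ρ ^ 2 * ‖∇ (moreauEnvelope F ρ) x‖ ^ 2 := by
    rw [← hgrad, norm_smul, mul_pow, Real.norm_eq_abs, sq_abs]
  have hgrowth := hw.growth hF x
  have hminorant := (add_inner_gradient_sub_le hd hs w).trans (hφ w)
  rw [sub_self, norm_zero, norm_sub_rev w x, hnorm] at hgrowth
  rw [← neg_sub x w, norm_neg, hnorm, inner_neg_right, real_inner_comm, ← hgrad,
    real_inner_smul_left] at hminorant
  have hcoeff : 1 / (2 * ρ) * (ρ ^ 2 * ‖∇ (moreauEnvelope F ρ) x‖ ^ 2)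
      + (1 / ρ - m) / 2 * (ρ ^ 2 * ‖∇ (moreauEnvelope F ρ) x‖ ^ 2)
      = (ρ - ρ ^ 2 * m / 2) * ‖∇ (moreauEnvelope F ρ) x‖ ^ 2 := by
    field_simp
    ring
  linarith

end Moreau

lemma exists_measurable_lt_of_separable {X Y : Type*} [MeasurableSpace X] [TopologicalSpace Y]
    [TopologicalSpace.SeparableSpace Y] [MeasurableSpace Y] {F : X → ℝ} {g : X → Y → ℝ}
    (hF : Measurable F) (hgx : ∀ x, Continuous (g x)) (hgy : ∀ y, Measurable fun x => g x y)
    (hex : ∀ x, ∃ y, F x < g x y) : ∃ s : X → Y, Measurable s ∧ ∀ x, F x < g x (s x) := by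
  classical
  rcases isEmpty_or_nonempty X with hX | hX
  · exact ⟨isEmptyElim, measurable_of_empty _, isEmptyElim⟩
  have : Nonempty Y := (hex hX.some).nonempty
  have hdense : ∀ x, ∃ k, F x < g x (TopologicalSpace.denseSeq Y k) := fun x =>
    (TopologicalSpace.denseRange_denseSeq Y).exists_mem_open
      (isOpen_lt continuous_const (hgx x)) (hex x)
  exact ⟨fun x => TopologicalSpace.denseSeq Y (Nat.find (hdense x)),
    measurable_from_nat.comp (measurable_find hdense fun k => measurableSet_lt hF (hgy _)),
    fun x => Nat.find_spec (hdense x)⟩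

lemma sub_le_of_concaveOn_of_hasFDerivWithinAt {E : Type*} [NormedAddCommGroup E]
    [NormedSpace ℝ E] {s : Set E} {φ : E → ℝ} {φ' : E →L[ℝ] ℝ} {p q : E} (hφ : ConcaveOn ℝ s φ)
    (hφ' : HasFDerivWithinAt φ φ' s p) (hp : p ∈ s) (hq : q ∈ s) : φ q - φ p ≤ φ' (q - p) := by
  have hmaps : Set.MapsTo (AffineMap.lineMap p q : ℝ → E) (Set.Icc 0 1) s :=
    fun _ ht => hφ.1.lineMap_mem hp hq ht
  have hconcave := (hφ.comp_affineMap (AffineMap.lineMap p q)).subset hmaps (convex_Icc 0 1)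
  have hderiv : HasDerivWithinAt (φ ∘ (AffineMap.lineMap p q : ℝ → E)) (φ' (q - p))
      (Set.Icc 0 1) 0 := by
    rw [← AffineMap.lineMap_apply_zero (k := ℝ) p q] at hφ'
    exact hφ'.comp_hasDerivWithinAt _ AffineMap.hasDerivWithinAt_lineMap hmaps
  simpa [slope_def_field] using hconcave.slope_le_of_hasDerivWithinAt
    (Set.left_mem_Icc.2 zero_le_one) (Set.right_mem_Icc.2 zero_le_one) zero_lt_one hderiv

lemma HasSimplexGradientAt.sub_le {n : ℕ} {φ : (Fin n → ℝ) → ℝ} {v p q : Fin n → ℝ}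
    (hv : HasSimplexGradientAt φ v p) (hφ : ConcaveOn ℝ (stdSimplex ℝ (Fin n)) φ)
    (hp : p ∈ stdSimplex ℝ (Fin n)) (hq : q ∈ stdSimplex ℝ (Fin n)) :
    φ q - φ p ≤ v ⬝ᵥ (q - p) := by
  simpa [dotProduct] using sub_le_of_concaveOn_of_hasFDerivWithinAt hφ hv hp hq

section Primal

variable {d n : ℕ} {f : EuclideanSpace ℝ (Fin d) → (Fin n → ℝ) → ℝ} {h : (Fin n → ℝ) → ℝ}
  {L l : ℝ}

lemma IsRegularObjective.le_primal (hΦ : IsRegularObjective f h L l)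
    (x : EuclideanSpace ℝ (Fin d)) {p : Fin n → ℝ} (hp : p ∈ stdSimplex ℝ (Fin n)) :
    f x p + h p ≤ primal f h x :=
  le_csSup ((isCompact_stdSimplex ℝ (Fin n)).bddAbove_image
    ((hΦ.continuous_f x).add hΦ.continuous_h)) (Set.mem_image_of_mem _ hp)

lemma IsRegularObjective.le_sSup_image (hΦ : IsRegularObjective f h L l) {p : Fin n → ℝ}
    (hp : p ∈ stdSimplex ℝ (Fin n)) : h p ≤ sSup (h '' stdSimplex ℝ (Fin n)) :=
  le_csSup ((isCompact_stdSimplex ℝ (Fin n)).bddAbove_image hΦ.continuous_h)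
    (Set.mem_image_of_mem _ hp)

lemma IsRegularObjective.exists_primal_eq (hΦ : IsRegularObjective f h L l)
    (hne : (stdSimplex ℝ (Fin n)).Nonempty) (x : EuclideanSpace ℝ (Fin d)) :
    ∃ p ∈ stdSimplex ℝ (Fin n), primal f h x = f x p + h p :=
  (isCompact_stdSimplex ℝ (Fin n)).exists_sSup_image_eq hne
    ((hΦ.continuous_f x).add hΦ.continuous_h)

lemma IsRegularObjective.abs_primal_sub_le (hΦ : IsRegularObjective f h L l)
    (hne : (stdSimplex ℝ (Fin n)).Nonempty) (x y : EuclideanSpace ℝ (Fin d)) :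
    |primal f h x - primal f h y| ≤ l * ‖x - y‖ := by
  obtain ⟨p, hp, hxp⟩ := hΦ.exists_primal_eq hne x
  obtain ⟨q, hq, hyq⟩ := hΦ.exists_primal_eq hne y
  have hyp := hΦ.le_primal y hp
  have hxq := hΦ.le_primal x hq
  rw [abs_le]
  exact ⟨by linarith [(abs_le.1 (hΦ.lipschitz q hq x y)).1],
    by linarith [(abs_le.1 (hΦ.lipschitz p hp x y)).2]⟩

lemma IsRegularObjective.continuous_primal (hΦ : IsRegularObjective f h L l)
    (hne : (stdSimplex ℝ (Fin n)).Nonempty) : Continuous (primal f h) :=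
  (LipschitzWith.of_dist_le' (hΦ.abs_primal_sub_le hne · ·)).continuous

lemma IsRegularObjective.strongConvexOn_primal (hΦ : IsRegularObjective f h L l)
    (hne : (stdSimplex ℝ (Fin n)).Nonempty) : StrongConvexOn Set.univ (-L) (primal f h) := by
  refine strongConvexOn_univ_of_exists_subgradient fun z => ?_
  obtain ⟨p, hp, hzp⟩ := hΦ.exists_primal_eq hne z
  refine ⟨innerₛₗ ℝ (∇ (fun y => f y p + h p) z), fun y => ?_⟩
  have hminorant := (add_inner_gradient_sub_le (hΦ.differentiable p hp)
    (hΦ.smooth p hp · z) y).trans (hΦ.le_primal y hp)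
  rw [hzp, innerₛₗ_apply_apply]
  linarith

lemma IsRegularObjective.exists_measurable_primal_lt (hΦ : IsRegularObjective f h L l)
    (hne : (stdSimplex ℝ (Fin n)).Nonempty) {δ : ℝ} (hδ : 0 < δ) :
    ∃ s : EuclideanSpace ℝ (Fin d) → Fin n → ℝ, Measurable s ∧
      (∀ x, s x ∈ stdSimplex ℝ (Fin n)) ∧ ∀ x, primal f h x < f x (s x) + h (s x) + δ := by
  obtain ⟨s, hs, hlt⟩ := exists_measurable_lt_of_separable (Y := {p // p ∈ stdSimplex ℝ (Fin n)})
    (g := fun x p => f x p.1 + h p.1 + δ) (hΦ.continuous_primal hne).measurable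
    (fun x => (continuousOn_iff_continuous_domRestrict.1
      ((hΦ.continuous_f x).add hΦ.continuous_h)).add_const δ)
    (fun p => ((hΦ.differentiable p.1 p.2).continuous.add_const δ).measurable) (fun x => by
      obtain ⟨p, hp, hxp⟩ := hΦ.exists_primal_eq hne x
      exact ⟨⟨p, hp⟩, by simp only [hxp, lt_add_iff_pos_right, hδ]⟩)
  exact ⟨fun x => (s x).1, measurable_subtype_coe.comp hs, fun x => (s x).2, hlt⟩

lemma gradient_add_const {E : Type*} [NormedAddCommGroup E] [InnerProductSpace ℝ E]
    [CompleteSpace E] (φ : E → ℝ) (c : ℝ) : ∇ (fun x => φ x + c) = ∇ φ :=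
  funext fun x => by simp only [gradient, fderiv_add_const]

-- The comparator `q` only has to be good at a nearby point `y`, which lets it stay frozen while the
-- minimization variable moves.
lemma IsRegularObjective.primal_sub_le (hΦ : IsRegularObjective f h L l)
    (hne : (stdSimplex ℝ (Fin n)).Nonempty) {x y : EuclideanSpace ℝ (Fin d)}
    {p q v : Fin n → ℝ} {δ : ℝ} (hp : p ∈ stdSimplex ℝ (Fin n)) (hq : q ∈ stdSimplex ℝ (Fin n))
    (hqy : primal f h y ≤ f y q + h q + δ) (hv : HasSimplexGradientAt (f x) v p) :
    primal f h x - (f x p + h p) ≤ δ + 2 * l * ‖x - y‖ + v ⬝ᵥ (q - p) + (h q - h p) := by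
  have hprimal := (abs_le.1 (hΦ.abs_primal_sub_le hne x y)).2
  have hobjective := (abs_le.1 (hΦ.lipschitz q hq x y)).1
  have hsupergradient := hv.sub_le (hΦ.concave_f x) hp hq
  linarith

end Primal

section Blocks

lemma sum_range_le_nsmul_of_blocks {M : Type*} [AddCommMonoid M] [PartialOrder M]
    [IsOrderedAddMonoid M] {a : ℕ → M} {B N T : ℕ} {c : M}
    (hblock : ∀ j e, j * B ≤ e → e ≤ (j + 1) * B → e ≤ T → ∑ t ∈ Ico (j * B) e, a t ≤ c)
    (hTN : T ≤ N * B) : ∑ t ∈ range T, a t ≤ N • c := by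
  induction N generalizing T with
  | zero => simp [Nat.le_zero.1 (hTN.trans_eq (zero_mul B))]
  | succ N ih =>
    have hc : 0 ≤ c := by simpa using hblock 0 0 (zero_mul B).le (Nat.zero_le _) (Nat.zero_le T)
    rw [succ_nsmul]
    rcases le_total T (N * B) with hT | hT
    · exact (ih hblock hT).trans (le_add_of_nonneg_right hc)
    · rw [← sum_range_add_sum_Ico _ hT]
      exact add_le_add (ih (fun j e hj hje he => hblock j e hj hje (he.trans hT)) le_rfl)
        (hblock N T hT hTN le_rfl)

-- Both sides agree whenever `B ∣ e`, and in between the correction term is nonnegative.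
lemma two_mul_sum_range_mod_add (e : ℕ) {B : ℕ} (hB : 0 < B) :
    2 * ∑ t ∈ range e, ((t % B : ℕ) : ℝ) + (e % B : ℕ) * (B - (e % B : ℕ)) = e * (B - 1) := by
  induction e with
  | zero => simp
  | succ e ih =>
    have hlt := Nat.mod_lt e hB
    rw [sum_range_succ]
    rcases (Nat.succ_le_of_lt hlt).eq_or_lt with hwrap | hnowrap
    · have hmod : (e + 1) % B = 0 := by
        rw [← Nat.mod_add_mod, ← Nat.succ_eq_add_one, hwrap, Nat.mod_self]
      have hB' : ((e % B : ℕ) : ℝ) + 1 = B := by exact_mod_cast hwrap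
      rw [hmod]
      rw [← hB'] at ih ⊢
      push_cast
      linarith
    · have hmod : (e + 1) % B = e % B + 1 := by
        rw [← Nat.mod_add_mod, Nat.mod_eq_of_lt hnowrap]
      rw [hmod]
      push_cast
      linarith

lemma two_mul_sum_range_mod_le (e : ℕ) {B : ℕ} (hB : 0 < B) :
    2 * ∑ t ∈ range e, ((t % B : ℕ) : ℝ) ≤ e * (B - 1) := by
  rw [← two_mul_sum_range_mod_add e hB]
  have hmod : ((e % B : ℕ) : ℝ) ≤ B := by exact_mod_cast (Nat.mod_lt e hB).le
  exact le_add_of_nonneg_right (mul_nonneg (Nat.cast_nonneg _) (sub_nonneg.2 hmod))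

end Blocks

section MirrorAscent

variable {n : ℕ} {h : (Fin n → ℝ) → ℝ} {lam K : ℝ} {T : ℕ} {p γ : ℕ → Fin n → ℝ}

lemma mem_stdSimplex_and_pos_of_isMirrorStep (hh : ConcaveOn ℝ (stdSimplex ℝ (Fin n)) h)
    (hlam : 0 < lam) (hstep : ∀ t < T, IsMirrorStep h lam (γ t) (p t) (p (t + 1)))
    (hp : p 0 ∈ stdSimplex ℝ (Fin n)) (hpos : ∀ i, 0 < p 0 i) {t : ℕ} (ht : t ≤ T) :
    p t ∈ stdSimplex ℝ (Fin n) ∧ ∀ i, 0 < p t i := by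
  induction t with
  | zero => exact ⟨hp, hpos⟩
  | succ t ih =>
    obtain ⟨htmem, htpos⟩ := ih (Nat.le_of_succ_le ht)
    exact ⟨(hstep t ht).1, (hstep t ht).pos hh hlam htmem htpos⟩

lemma sum_Ico_regret_le_of_isMirrorStep (hh : ConcaveOn ℝ (stdSimplex ℝ (Fin n)) h)
    (hlam : 0 < lam) (hstep : ∀ t < T, IsMirrorStep h lam (γ t) (p t) (p (t + 1)))
    (hp : ∀ t ≤ T, p t ∈ stdSimplex ℝ (Fin n)) (hpos : ∀ t ≤ T, ∀ i, 0 < p t i)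
    {q : Fin n → ℝ} (hq : q ∈ stdSimplex ℝ (Fin n)) {s e : ℕ} (hse : s ≤ e) (heT : e ≤ T) :
    ∑ t ∈ Ico s e, (h q - h (p (t + 1)) + γ t ⬝ᵥ (q - p t) - lam * ‖γ t‖ ^ 2)
      ≤ 1 / (2 * lam) * klSum q (p s) := by
  have hregret : ∀ t ∈ Ico s e, h q - h (p (t + 1)) + γ t ⬝ᵥ (q - p t) - lam * ‖γ t‖ ^ 2
      ≤ -(1 / (2 * lam) * klSum q (p (t + 1))) - -(1 / (2 * lam) * klSum q (p t)) := by
    intro t ht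
    have htT : t < T := (mem_Ico.1 ht).2.trans_le heT
    linarith [(hstep t htT).regret_le hh hlam (hp t htT.le) (hpos t htT.le) hq]
  have hnonneg : 0 ≤ 1 / (2 * lam) * klSum q (p e) := mul_nonneg (by positivity)
    (klSum_nonneg hq (hp e heT) fun i hi => absurd hi (hpos e heT i).ne')
  refine (sum_le_sum hregret).trans ?_
  rw [sum_Ico_sub (fun t => -(1 / (2 * lam) * klSum q (p t))) hse]
  linarith

-- Switching to a new comparator costs one restart of the telescoping sum, that is `K / (2 * lam)`.
lemma sum_regret_blocks_le_of_isMirrorStep (hh : ConcaveOn ℝ (stdSimplex ℝ (Fin n)) h)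
    (hlam : 0 < lam) (hstep : ∀ t < T, IsMirrorStep h lam (γ t) (p t) (p (t + 1)))
    (hp : ∀ t ≤ T, p t ∈ stdSimplex ℝ (Fin n)) (hpos : ∀ t ≤ T, ∀ i, 0 < p t i)
    (hK₀ : 0 ≤ K) (hK : ∀ t < T, ∀ q ∈ stdSimplex ℝ (Fin n), klSum q (p t) ≤ K) {c : ℕ → Fin n → ℝ}
    (hc : ∀ j, c j ∈ stdSimplex ℝ (Fin n)) {B N : ℕ} (hTN : T ≤ N * B) :
    ∑ t ∈ range T,
        (h (c (t / B)) - h (p (t + 1)) + γ t ⬝ᵥ (c (t / B) - p t) - lam * ‖γ t‖ ^ 2)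
      ≤ N * (1 / (2 * lam) * K) := by
  rw [← nsmul_eq_mul]
  refine sum_range_le_nsmul_of_blocks (fun j e hj hje heT => ?_) hTN
  have hdiv : ∀ t ∈ Ico (j * B) e, t / B = j := fun t ht =>
    Nat.div_eq_of_lt_le (mem_Ico.1 ht).1 ((mem_Ico.1 ht).2.trans_le hje)
  rcases hj.eq_or_lt with rfl | hlt
  · simpa using mul_nonneg (inv_nonneg.2 (mul_nonneg zero_le_two hlam.le)) hK₀
  rw [sum_congr rfl fun t ht => by rw [hdiv t ht]]
  refine (sum_Ico_regret_le_of_isMirrorStep hh hlam hstep hp hpos (hc j) hj heT).trans ?_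
  gcongr
  exact hK _ (hlt.trans_le heT) _ (hc j)

end MirrorAscent

section Pathwise

lemma sum_inner_gradient_moreauEnvelope_le {d : ℕ} {F : EuclideanSpace ℝ (Fin d) → ℝ}
    {ρ m η : ℝ} (hρ : 0 < ρ) (hρm : ρ * m < 1) (hF : StrongConvexOn Set.univ (-m) F)
    (hc : Continuous F) (hb : BddBelow (Set.range F)) {T : ℕ}
    {x g : ℕ → EuclideanSpace ℝ (Fin d)} (hx : ∀ t < T, x (t + 1) = x t - η • g t) :
    η * ∑ t ∈ range T, ⟪∇ (moreauEnvelope F ρ) (x t), g t⟫_ℝ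
      ≤ moreauEnvelope F ρ (x 0) - (⨅ y, moreauEnvelope F ρ y)
        + 1 / (2 * ρ) * η ^ 2 * ∑ t ∈ range T, ‖g t‖ ^ 2 := by
  have hdescent : ∀ t ∈ range T, η * ⟪∇ (moreauEnvelope F ρ) (x t), g t⟫_ℝ
      ≤ moreauEnvelope F ρ (x t) - moreauEnvelope F ρ (x (t + 1))
        + 1 / (2 * ρ) * η ^ 2 * ‖g t‖ ^ 2 := by
    intro t ht
    have hsmooth := moreauEnvelope_le_add_inner_gradient hρ hρm hF hc hb (x t) (x (t + 1))
    rw [show x (t + 1) - x t = -(η • g t) by rw [hx t (mem_range.1 ht)]; abel, inner_neg_right,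
      inner_smul_right, norm_neg, norm_smul, mul_pow, Real.norm_eq_abs, sq_abs] at hsmooth
    linarith
  have hinf : ⨅ y, moreauEnvelope F ρ y ≤ moreauEnvelope F ρ (x T) :=
    ciInf_le (bddBelow_range_moreauEnvelope hρ.le hb) _
  rw [mul_sum, mul_sum]
  refine (sum_le_sum hdescent).trans ?_
  rw [sum_add_distrib, sum_range_sub']
  linarith

lemma sum_norm_sq_gradient_moreauEnvelope_le {d : ℕ} {F : EuclideanSpace ℝ (Fin d) → ℝ}
    {ρ m η : ℝ} (hρ : 0 < ρ) (hρm : ρ * m < 1) (hF : StrongConvexOn Set.univ (-m) F)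
    (hc : Continuous F) (hb : BddBelow (Set.range F)) (hη : 0 < η) {T : ℕ}
    {x g : ℕ → EuclideanSpace ℝ (Fin d)} (hx : ∀ t < T, x (t + 1) = x t - η • g t)
    {φ : ℕ → EuclideanSpace ℝ (Fin d) → ℝ} (hφ : ∀ t < T, ∀ y, φ t y ≤ F y)
    (hd : ∀ t < T, Differentiable ℝ (φ t))
    (hs : ∀ t < T, ∀ y, ‖∇ (φ t) y - ∇ (φ t) (x t)‖ ≤ m * ‖y - x t‖) :
    ρ * (1 - ρ * m) * ∑ t ∈ range T, ‖∇ (moreauEnvelope F ρ) (x t)‖ ^ 2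
      ≤ ρ / η * (moreauEnvelope F ρ (x 0) - ⨅ y, moreauEnvelope F ρ y)
        + ∑ t ∈ range T, (ρ * ⟪∇ (moreauEnvelope F ρ) (x t), ∇ (φ t) (x t) - g t⟫_ℝ
          + η / 2 * ‖g t‖ ^ 2 + (F (x t) - φ t (x t))) := by
  have hstationary : ∀ t ∈ range T, ρ * (1 - ρ * m) * ‖∇ (moreauEnvelope F ρ) (x t)‖ ^ 2
      ≤ F (x t) - φ t (x t) + ρ * ⟪∇ (moreauEnvelope F ρ) (x t), ∇ (φ t) (x t)⟫_ℝ := by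
    intro t ht
    have htT := mem_range.1 ht
    exact norm_sq_gradient_moreauEnvelope_le hρ hρm hF hc hb (hd t htT) (hs t htT) (hφ t htT)
  have hdescent : ρ * ∑ t ∈ range T, ⟪∇ (moreauEnvelope F ρ) (x t), g t⟫_ℝ
      ≤ ρ / η * (moreauEnvelope F ρ (x 0) - ⨅ y, moreauEnvelope F ρ y)
        + η / 2 * ∑ t ∈ range T, ‖g t‖ ^ 2 := by
    have hscaled := mul_le_mul_of_nonneg_left
      (sum_inner_gradient_moreauEnvelope_le hρ hρm hF hc hb hx) (div_pos hρ hη).le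
    have hsquare : ρ / η * (1 / (2 * ρ) * η ^ 2) = η / 2 := by field_simp
    rwa [mul_add, ← mul_assoc, div_mul_cancel₀ _ hη.ne', ← mul_assoc, hsquare] at hscaled
  rw [mul_sum]
  refine (sum_le_sum hstationary).trans ?_
  simp only [inner_sub_right, mul_sub, sum_add_distrib, sum_sub_distrib, ← mul_sum] at *
  linarith

variable {d n : ℕ} {f : EuclideanSpace ℝ (Fin d) → (Fin n → ℝ) → ℝ} {h : (Fin n → ℝ) → ℝ}
  {L l : ℝ}

lemma IsRegularObjective.sum_primal_sub_le (hΦ : IsRegularObjective f h L l) {lam K δ : ℝ}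
    (hlam : 0 < lam) (hK₀ : 0 ≤ K) {B N T : ℕ} (hTN : T ≤ N * B)
    {x : ℕ → EuclideanSpace ℝ (Fin d)} {p γ v : ℕ → Fin n → ℝ}
    (hstep : ∀ t < T, IsMirrorStep h lam (γ t) (p t) (p (t + 1)))
    (hp : p 0 ∈ stdSimplex ℝ (Fin n)) (hpos : ∀ i, 0 < p 0 i)
    (hK : ∀ t < T, ∀ q ∈ stdSimplex ℝ (Fin n), klSum q (p t) ≤ K)
    (hv : ∀ t < T, HasSimplexGradientAt (f (x t)) (v t) (p t))
    {s : EuclideanSpace ℝ (Fin d) → Fin n → ℝ} (hs : ∀ y, s y ∈ stdSimplex ℝ (Fin n))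
    (hsδ : ∀ y, primal f h y ≤ f y (s y) + h (s y) + δ) :
    ∑ t ∈ range T, (primal f h (x t) - (f (x t) (p t) + h (p t)))
      ≤ N * (1 / (2 * lam) * K) + (sSup (h '' stdSimplex ℝ (Fin n)) - h (p 0)) + T * δ
        + ∑ t ∈ range T, (2 * l * ‖x t - x (t / B * B)‖
          + (s (x (t / B * B)) - p t) ⬝ᵥ (v t - γ t) + lam * ‖γ t‖ ^ 2) := by
  have hiter := fun t ht =>
    mem_stdSimplex_and_pos_of_isMirrorStep hΦ.concave_h hlam hstep hp hpos (t := t) ht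
  have hregret := sum_regret_blocks_le_of_isMirrorStep hΦ.concave_h hlam hstep
    (fun t ht => (hiter t ht).1) (fun t ht => (hiter t ht).2) hK₀ hK
    (c := fun j => s (x (j * B))) (fun j => hs _) hTN
  have hlast := hΦ.le_sSup_image (hiter T le_rfl).1
  have hgap : ∀ t ∈ range T, primal f h (x t) - (f (x t) (p t) + h (p t))
      ≤ (h (s (x (t / B * B))) - h (p (t + 1)) + γ t ⬝ᵥ (s (x (t / B * B)) - p t)
          - lam * ‖γ t‖ ^ 2) + (h (p (t + 1)) - h (p t)) + δ
        + (2 * l * ‖x t - x (t / B * B)‖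
          + (s (x (t / B * B)) - p t) ⬝ᵥ (v t - γ t) + lam * ‖γ t‖ ^ 2) := by
    intro t ht
    have htT := mem_range.1 ht
    have hfrozen := hΦ.primal_sub_le ⟨_, hp⟩ (hiter t htT.le).1 (hs (x (t / B * B)))
      (hsδ (x (t / B * B))) (hv t htT)
    rw [dotProduct_comm _ (v t - γ t), sub_dotProduct]
    linarith
  refine (sum_le_sum hgap).trans ?_
  rw [sum_add_distrib, sum_add_distrib, sum_add_distrib, sum_range_sub (fun t => h (p t)),
    sum_const, card_range, nsmul_eq_mul]
  linarith

end Pathwise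

section Probability

variable {Ω : Type*} {mΩ : MeasurableSpace Ω} {μ : Measure Ω}

/-- The random variable `X` has mean at most `c`. Integrability is part of the notion, since the
integral of a non-integrable function is `0`. -/
def MeanLE (μ : Measure Ω) (X : Ω → ℝ) (c : ℝ) : Prop :=
  Integrable X μ ∧ ∫ ω, X ω ∂μ ≤ c

lemma meanLE_const [IsProbabilityMeasure μ] (c : ℝ) : MeanLE μ (fun _ => c) c :=
  ⟨integrable_const c, by simp⟩

namespace MeanLE

variable {X Y : Ω → ℝ} {a b c : ℝ}

lemma add (hX : MeanLE μ X a) (hY : MeanLE μ Y b) : MeanLE μ (fun ω => X ω + Y ω) (a + b) :=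
  ⟨hX.1.add hY.1, (integral_add hX.1 hY.1).trans_le (add_le_add hX.2 hY.2)⟩

lemma const_mul (hX : MeanLE μ X a) (hc : 0 ≤ c) : MeanLE μ (fun ω => c * X ω) (c * a) :=
  ⟨hX.1.const_mul c, (integral_const_mul c X).trans_le (mul_le_mul_of_nonneg_left hX.2 hc)⟩

lemma sum {ι : Type*} {s : Finset ι} {X : ι → Ω → ℝ} {a : ι → ℝ}
    (hX : ∀ i ∈ s, MeanLE μ (X i) (a i)) : MeanLE μ (fun ω => ∑ i ∈ s, X i ω) (∑ i ∈ s, a i) :=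
  ⟨integrable_finsetSum s fun i hi => (hX i hi).1,
    (integral_finsetSum s fun i hi => (hX i hi).1).trans_le (sum_le_sum fun i hi => (hX i hi).2)⟩

lemma congr (hX : MeanLE μ X a) (hXY : X =ᵐ[μ] Y) : MeanLE μ Y a :=
  ⟨hX.1.congr hXY, (integral_congr_ae hXY).symm.trans_le hX.2⟩

lemma of_nonneg_of_le (hY : MeanLE μ Y a) (hX : AEStronglyMeasurable X μ)
    (h0 : ∀ᵐ ω ∂μ, 0 ≤ X ω) (hXY : ∀ᵐ ω ∂μ, X ω ≤ Y ω) : MeanLE μ X a := by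
  have hXi : Integrable X μ := by
    refine hY.1.mono' hX ?_
    filter_upwards [h0, hXY] with ω hω hωY
    rwa [Real.norm_of_nonneg hω]
  exact ⟨hXi, (integral_mono_ae hXi hY.1 hXY).trans hY.2⟩

end MeanLE

lemma meanLE_bilin_condExp_sub [IsFiniteMeasure μ] {E F : Type*}
    [NormedAddCommGroup E] [NormedSpace ℝ E] [CompleteSpace E]
    [NormedAddCommGroup F] [NormedSpace ℝ F] (B : F →L[ℝ] E →L[ℝ] ℝ) {m : MeasurableSpace Ω}
    (hm : m ≤ mΩ) {X : Ω → F} {g : Ω → E} {c : ℝ} (hX : StronglyMeasurable[m] X)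
    (hc : ∀ᵐ ω ∂μ, ‖X ω‖ ≤ c) (hg : Integrable g μ) :
    MeanLE μ (fun ω => B (X ω) ((μ[g | m]) ω - g ω)) 0 := by
  have hX' : AEStronglyMeasurable[mΩ] X μ := (hX.mono hm).aestronglyMeasurable
  have hXu := B.integrable_of_bilin_of_bdd_left c hX' hc (integrable_condExp (m := m) (f := g))
  have hXg := B.integrable_of_bilin_of_bdd_left c hX' hc hg
  simp only [map_sub]
  refine ⟨hXu.sub hXg, le_of_eq ?_⟩
  rw [integral_sub hXu hXg, sub_eq_zero,
    ← integral_congr_ae (condExp_stronglyMeasurable_bilin_of_bound B hm hX hg c hc),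
    integral_condExp hm]

lemma meanLE_norm_sq_of_condExp [IsProbabilityMeasure μ] {E : Type*} [NormedAddCommGroup E]
    [InnerProductSpace ℝ E] [CompleteSpace E] {m : MeasurableSpace Ω} (hm : m ≤ mΩ) {g : Ω → E}
    {l V : ℝ} (hg : MemLp g 2 μ) (hl : ∀ᵐ ω ∂μ, ‖(μ[g | m]) ω‖ ≤ l)
    (hV : ∫ ω, ‖g ω - (μ[g | m]) ω‖ ^ 2 ∂μ ≤ V) :
    MeanLE μ (fun ω => ‖g ω‖ ^ 2) (l ^ 2 + V) := by
  set u := μ[g | m]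
  have hu : StronglyMeasurable[m] u := stronglyMeasurable_condExp
  have hu₂ : MemLp u 2 μ := MemLp.of_bound (hu.mono hm).aestronglyMeasurable l hl
  have hbias : MeanLE μ (fun ω => ‖u ω‖ ^ 2) (l ^ 2) := by
    refine (meanLE_const _).of_nonneg_of_le (hu₂.integrable_norm_pow two_ne_zero).1
      (ae_of_all _ fun ω => sq_nonneg _) ?_
    filter_upwards [hl] with ω hω
    gcongr
  have hvar : MeanLE μ (fun ω => ‖g ω - u ω‖ ^ 2) V :=
    ⟨(hg.sub hu₂).integrable_norm_pow two_ne_zero, hV⟩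
  have hcross : MeanLE μ (fun ω => ⟪-u ω, u ω - g ω⟫_ℝ) 0 :=
    meanLE_bilin_condExp_sub (innerSL ℝ) hm hu.neg (by simpa using hl) (hg.integrable one_le_two)
  have hpythagoras : ∀ ω, ‖u ω‖ ^ 2 + ‖g ω - u ω‖ ^ 2 + 2 * ⟪-u ω, u ω - g ω⟫_ℝ = ‖g ω‖ ^ 2 := by
    intro ω
    rw [norm_sub_sq_real, inner_neg_left, inner_sub_right, real_inner_self_eq_norm_sq,
      real_inner_comm]
    ring
  simpa only [hpythagoras, mul_zero, add_zero] using
    (hbias.add hvar).add (hcross.const_mul zero_le_two)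

lemma MeanLE.norm_of_norm_sq [IsProbabilityMeasure μ] {E : Type*} [NormedAddCommGroup E]
    {g : Ω → E} {c : ℝ} (h : MeanLE μ (fun ω => ‖g ω‖ ^ 2) c) (hg : AEStronglyMeasurable g μ) :
    MeanLE μ (fun ω => ‖g ω‖) √c := by
  have hg₂ : MemLp g 2 μ := (memLp_two_iff_integrable_sq_norm hg).2 h.1
  have hvar := variance_nonneg (fun ω => ‖g ω‖) μ
  rw [variance_eq_sub hg₂.norm, sub_nonneg] at hvar
  exact ⟨(hg₂.integrable one_le_two).norm, Real.le_sqrt_of_sq_le (hvar.trans h.2)⟩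

lemma meanLE_norm_sub {E : Type*} [NormedAddCommGroup E] [NormedSpace ℝ E] {x g : ℕ → Ω → E}
    {η S : ℝ} {s t : ℕ} (hη : 0 ≤ η) (hst : s ≤ t)
    (hx : ∀ i ∈ Ico s t, ∀ᵐ ω ∂μ, x (i + 1) ω = x i ω - η • g i ω)
    (hxm : AEStronglyMeasurable (fun ω => x t ω - x s ω) μ)
    (hg : ∀ i ∈ Ico s t, MeanLE μ (fun ω => ‖g i ω‖) S) :
    MeanLE μ (fun ω => ‖x t ω - x s ω‖) (η * ((t - s : ℕ) * S)) := by
  have hpath : MeanLE μ (fun ω => η * ∑ i ∈ Ico s t, ‖g i ω‖) (η * ((t - s : ℕ) * S)) := by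
    simpa using (MeanLE.sum hg).const_mul hη
  refine hpath.of_nonneg_of_le hxm.norm (ae_of_all _ fun ω => norm_nonneg _) ?_
  filter_upwards [(ae_ball_iff (Finset.countable_toSet (Ico s t))).2 hx] with ω hω
  rw [norm_sub_rev, ← dist_eq_norm, mul_sum]
  refine dist_le_Ico_sum_of_dist_le (f := fun i => x i ω) hst fun {i} hsi hit => le_of_eq ?_
  rw [hω i (mem_Ico.2 ⟨hsi, hit⟩), dist_eq_norm, sub_sub_cancel, norm_smul,
    Real.norm_of_nonneg hη]

lemma measurable_gradient {E : Type*} [NormedAddCommGroup E] [InnerProductSpace ℝ E]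
    [CompleteSpace E] [MeasurableSpace E] [BorelSpace E] (φ : E → ℝ) : Measurable (∇ φ) :=
  (InnerProductSpace.toDual ℝ E).symm.continuous.measurable.comp (measurable_fderiv ℝ φ)

end Probability

section Run

variable {d n : ℕ} {f : EuclideanSpace ℝ (Fin d) → (Fin n → ℝ) → ℝ} {h : (Fin n → ℝ) → ℝ}
  {L l : ℝ}

lemma IsRegularObjective.sum_norm_sq_gradient_le (hΦ : IsRegularObjective f h L l)
    (hL : 0 < L) (hb : BddBelow (Set.range (primal f h))) {η lam K δ : ℝ} (hη : 0 < η)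
    (hlam : 0 < lam) (hK₀ : 0 ≤ K) {B N T : ℕ} (hTN : T ≤ N * B)
    {x g u : ℕ → EuclideanSpace ℝ (Fin d)} {p γ v : ℕ → Fin n → ℝ}
    (hx : ∀ t < T, x (t + 1) = x t - η • g t)
    (hstep : ∀ t < T, IsMirrorStep h lam (γ t) (p t) (p (t + 1)))
    (hp : p 0 ∈ stdSimplex ℝ (Fin n)) (hpos : ∀ i, 0 < p 0 i)
    (hK : ∀ t < T, ∀ q ∈ stdSimplex ℝ (Fin n), klSum q (p t) ≤ K)
    (hu : ∀ t < T, u t = ∇ (fun y => f y (p t)) (x t))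
    (hv : ∀ t < T, HasSimplexGradientAt (f (x t)) (v t) (p t))
    {s : EuclideanSpace ℝ (Fin d) → Fin n → ℝ} (hs : ∀ y, s y ∈ stdSimplex ℝ (Fin n))
    (hsδ : ∀ y, primal f h y ≤ f y (s y) + h (s y) + δ) :
    ∑ t ∈ range T, ‖∇ (moreauEnvelope (primal f h) (1 / (2 * L))) (x t)‖ ^ 2
      ≤ 2 * (moreauEnvelope (primal f h) (1 / (2 * L)) (x 0)
          - ⨅ y, moreauEnvelope (primal f h) (1 / (2 * L)) y) / η
        + 4 * L * (N * (1 / (2 * lam) * K) + (sSup (h '' stdSimplex ℝ (Fin n)) - h (p 0)) + T * δ)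
        + ∑ t ∈ range T,
          (2 * ⟪∇ (moreauEnvelope (primal f h) (1 / (2 * L))) (x t), u t - g t⟫_ℝ
            + 2 * L * η * ‖g t‖ ^ 2
            + 4 * L * (2 * l * ‖x t - x (t / B * B)‖
              + (s (x (t / B * B)) - p t) ⬝ᵥ (v t - γ t) + lam * ‖γ t‖ ^ 2)) := by
  have hne : (stdSimplex ℝ (Fin n)).Nonempty := ⟨_, hp⟩
  have hmem : ∀ t < T, p t ∈ stdSimplex ℝ (Fin n) := fun t ht =>
    (mem_stdSimplex_and_pos_of_isMirrorStep hΦ.concave_h hlam hstep hp hpos ht.le).1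
  have hρL : 1 / (2 * L) * L = 1 / 2 := by field_simp
  have hdescent := sum_norm_sq_gradient_moreauEnvelope_le (ρ := 1 / (2 * L)) (by positivity)
    (by rw [hρL]; norm_num) (hΦ.strongConvexOn_primal hne) (hΦ.continuous_primal hne) hb hη hx
    (φ := fun t y => f y (p t) + h (p t)) (fun t ht y => hΦ.le_primal y (hmem t ht))
    (fun t ht => hΦ.differentiable _ (hmem t ht)) (fun t ht y => hΦ.smooth _ (hmem t ht) y _)
  have hascent := hΦ.sum_primal_sub_le hlam hK₀ hTN hstep hp hpos hK hv hs hsδ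
  have hinner : ∑ t ∈ range T, ⟪∇ (moreauEnvelope (primal f h) (1 / (2 * L))) (x t),
        ∇ (fun y => f y (p t) + h (p t)) (x t) - g t⟫_ℝ
      = ∑ t ∈ range T, ⟪∇ (moreauEnvelope (primal f h) (1 / (2 * L))) (x t), u t - g t⟫_ℝ :=
    sum_congr rfl fun t ht => by rw [gradient_add_const, hu t (mem_range.1 ht)]
  simp only [sum_add_distrib, ← mul_sum] at hdescent hascent ⊢
  rw [hρL, hinner] at hdescent
  have hscaled := mul_le_mul_of_nonneg_left (hdescent.trans (add_le_add_right
    (add_le_add_right hascent _) _)) (by positivity : 0 ≤ 4 * L)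
  refine le_of_eq_of_le ?_ (hscaled.trans_eq ?_) <;> field_simp <;> ring

lemma klSum_le_of_klDiv_le {p q r : Fin n → ℝ} {R α : ℝ} (hp : p ∈ stdSimplex ℝ (Fin n))
    (hq : q ∈ stdSimplex ℝ (Fin n)) (hr : r ∈ stdSimplex ℝ (Fin n)) (hα : 0 < α)
    (hαp : ∀ i, α ≤ p i) (hR : klDiv p q ≤ (R : EReal)) : klSum r q ≤ (R + 1) / α := by
  obtain ⟨hpq, hsum⟩ := klDiv_le_coe_iff.1 hR
  exact (klSum_le_add_one_div hp hq hr hpq hα hαp).trans (by gcongr)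

variable {Ω : Type*} {mΩ : MeasurableSpace Ω} {μ : Measure Ω} {ℱ : Filtration ℕ mΩ}
  {σ G η lam : ℝ} {T : ℕ} {θ₀ : EuclideanSpace ℝ (Fin d)} {π₀ : Fin n → ℝ}
  {θ gθ : ℕ → Ω → EuclideanSpace ℝ (Fin d)} {π gπ : ℕ → Ω → Fin n → ℝ}

lemma IsRun.mem_stdSimplex (hrun : IsRun μ ℱ h T η lam θ₀ π₀ θ gθ π gπ) {t : ℕ} (ht : t ≤ T) :
    ∀ᵐ ω ∂μ, π t ω ∈ stdSimplex ℝ (Fin n) := by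
  cases t with
  | zero => exact ae_of_all _ fun ω => hrun.init_π ω ▸ hrun.init_mem
  | succ t => exact (hrun.step_π t ht).mono fun ω hω => hω.1

lemma IsUnbiasedOracle.ae_sum_norm_sq_gradient_le
    (ho : IsUnbiasedOracle μ ℱ f T σ G θ gθ π gπ) (hΦ : IsRegularObjective f h L l)
    (hrun : IsRun μ ℱ h T η lam θ₀ π₀ θ gθ π gπ) (hL : 0 < L)
    (hb : BddBelow (Set.range (primal f h))) (hη : 0 < η) (hlam : 0 < lam) (hT : 0 < T)
    {R α : ℝ} (hR : 0 ≤ R) {pEmp : Fin n → ℝ} (hpEmp : pEmp ∈ stdSimplex ℝ (Fin n))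
    (hα : 0 < α) (hαp : ∀ i, α ≤ pEmp i)
    (hKL : ∀ t < T, ∀ᵐ ω ∂μ, klDiv pEmp (π t ω) ≤ (R : EReal)) {B N : ℕ} (hTN : T ≤ N * B)
    {δ : ℝ} {s : EuclideanSpace ℝ (Fin d) → Fin n → ℝ} (hs : ∀ y, s y ∈ stdSimplex ℝ (Fin n))
    (hsδ : ∀ y, primal f h y ≤ f y (s y) + h (s y) + δ) :
    ∀ᵐ ω ∂μ, ∑ t ∈ range T, ‖∇ (moreauEnvelope (primal f h) (1 / (2 * L))) (θ t ω)‖ ^ 2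
      ≤ 2 * (moreauEnvelope (primal f h) (1 / (2 * L)) θ₀
          - ⨅ y, moreauEnvelope (primal f h) (1 / (2 * L)) y) / η
        + 4 * L * (N * (1 / (2 * lam) * ((R + 1) / α))
          + (sSup (h '' stdSimplex ℝ (Fin n)) - h π₀) + T * δ)
        + ∑ t ∈ range T,
          (2 * ⟪∇ (moreauEnvelope (primal f h) (1 / (2 * L))) (θ t ω),
              (μ[gθ t | ℱ t]) ω - gθ t ω⟫_ℝ
            + 2 * L * η * ‖gθ t ω‖ ^ 2
            + 4 * L * (2 * l * ‖θ t ω - θ (t / B * B) ω‖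
              + (s (θ (t / B * B) ω) - π t ω) ⬝ᵥ ((μ[gπ t | ℱ t]) ω - gπ t ω)
              + lam * ‖gπ t ω‖ ^ 2)) := by
  have hall {P : ℕ → Ω → Prop} (hP : ∀ t < T, ∀ᵐ ω ∂μ, P t ω) : ∀ᵐ ω ∂μ, ∀ t < T, P t ω :=
    (ae_ball_iff (Set.to_countable (Set.Iio T))).2 hP
  filter_upwards [hall hrun.step_θ, hall hrun.step_π, hall ho.unbiased_θ, hall ho.unbiased_π,
    hall hKL, hall fun t ht => hrun.mem_stdSimplex ht.le] with ω hθ hπ hu hv hKLω hmem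
  have hpos : ∀ i, 0 < π 0 ω i := fun i => ((hmem 0 hT).1 i).lt_of_ne' fun h0 =>
    (hα.trans_le (hαp i)).ne' ((klDiv_le_coe_iff.1 (hKLω 0 hT)).1 i h0)
  have hpath := hΦ.sum_norm_sq_gradient_le hL hb hη hlam (K := (R + 1) / α) (by positivity) hTN
    hθ hπ (hmem 0 hT) hpos
    (fun t ht q hq => klSum_le_of_klDiv_le hpEmp (hmem t ht) hq hα hαp (hKLω t ht)) hu hv hs hsδ
  rwa [hrun.init_θ, hrun.init_π] at hpath

variable [IsProbabilityMeasure μ]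

lemma IsUnbiasedOracle.meanLE_norm_sq_θ (ho : IsUnbiasedOracle μ ℱ f T σ G θ gθ π gπ)
    (hΦ : IsRegularObjective f h L l) (hl : 0 ≤ l)
    (hrun : IsRun μ ℱ h T η lam θ₀ π₀ θ gθ π gπ) {t : ℕ} (ht : t < T) :
    MeanLE μ (fun ω => ‖gθ t ω‖ ^ 2) (l ^ 2 + σ ^ 2) := by
  refine meanLE_norm_sq_of_condExp (ℱ.le t) (ho.memLp_θ t ht) ?_ (ho.variance_θ t ht)
  filter_upwards [ho.unbiased_θ t ht, hrun.mem_stdSimplex ht.le] with ω hω hmem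
  rw [hω, ← gradient_add_const _ (h (π t ω))]
  exact norm_gradient_le_of_abs_sub_le hl (hΦ.lipschitz _ hmem) _

lemma IsUnbiasedOracle.meanLE_norm_sub_θ (ho : IsUnbiasedOracle μ ℱ f T σ G θ gθ π gπ)
    (hΦ : IsRegularObjective f h L l) (hl : 0 ≤ l) (hη : 0 ≤ η)
    (hrun : IsRun μ ℱ h T η lam θ₀ π₀ θ gθ π gπ) {s t : ℕ} (hst : s ≤ t) (ht : t < T) :
    MeanLE μ (fun ω => ‖θ t ω - θ s ω‖) (η * ((t - s : ℕ) * √(l ^ 2 + σ ^ 2))) := by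
  have hmeas : ∀ i ≤ T, Measurable (θ i) := fun i hi =>
    (hrun.measurable_θ i hi).mono (ℱ.le i) le_rfl
  refine meanLE_norm_sub hη hst (fun i hi => hrun.step_θ i ((mem_Ico.1 hi).2.trans ht))
    ((hmeas t ht.le).sub (hmeas s (hst.trans ht.le))).aestronglyMeasurable fun i hi => ?_
  have hiT : i < T := (mem_Ico.1 hi).2.trans ht
  exact (ho.meanLE_norm_sq_θ hΦ hl hrun hiT).norm_of_norm_sq (ho.memLp_θ i hiT).1

lemma IsUnbiasedOracle.meanLE_inner_noise (ho : IsUnbiasedOracle μ ℱ f T σ G θ gθ π gπ)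
    (hrun : IsRun μ ℱ h T η lam θ₀ π₀ θ gθ π gπ)
    {X : EuclideanSpace ℝ (Fin d) → EuclideanSpace ℝ (Fin d)} (hX : Measurable X) {c : ℝ}
    (hc : ∀ x, ‖X x‖ ≤ c) {t : ℕ} (ht : t < T) :
    MeanLE μ (fun ω => ⟪X (θ t ω), (μ[gθ t | ℱ t]) ω - gθ t ω⟫_ℝ) 0 :=
  meanLE_bilin_condExp_sub (innerSL ℝ) (ℱ.le t)
    (hX.comp (hrun.measurable_θ t ht.le)).stronglyMeasurable (ae_of_all _ fun _ => hc _)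
    ((ho.memLp_θ t ht).integrable one_le_two)

lemma IsUnbiasedOracle.meanLE_dotProduct_noise (ho : IsUnbiasedOracle μ ℱ f T σ G θ gθ π gπ)
    (hrun : IsRun μ ℱ h T η lam θ₀ π₀ θ gθ π gπ)
    {sel : EuclideanSpace ℝ (Fin d) → Fin n → ℝ} (hsel : Measurable sel)
    (hmem : ∀ x, sel x ∈ stdSimplex ℝ (Fin n)) {s t : ℕ} (hst : s ≤ t) (ht : t < T) :
    MeanLE μ (fun ω => (sel (θ s ω) - π t ω) ⬝ᵥ ((μ[gπ t | ℱ t]) ω - gπ t ω)) 0 := by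
  have hnorm : ∀ {p}, p ∈ stdSimplex ℝ (Fin n) → ‖p‖ ≤ 1 := fun hp =>
    mem_closedBall_zero_iff.1 (stdSimplex_subset_closedBall hp)
  refine meanLE_bilin_condExp_sub (dotProductBilin ℝ ℝ).toContinuousBilinearMap (ℱ.le t)
    (X := fun ω => sel (θ s ω) - π t ω) (c := 1 + 1) ?_ ?_
    ((ho.memLp_π t ht).integrable one_le_two)
  · exact ((hsel.comp ((hrun.measurable_θ s (hst.trans ht.le)).mono (ℱ.mono hst) le_rfl)).sub
      (hrun.measurable_π t ht.le)).stronglyMeasurable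
  · filter_upwards [hrun.mem_stdSimplex ht.le] with ω hω
    exact (norm_sub_le _ _).trans (add_le_add (hnorm (hmem _)) (hnorm hω))

end Run

section ExpectedRate

variable {d n : ℕ} {f : EuclideanSpace ℝ (Fin d) → (Fin n → ℝ) → ℝ} {h : (Fin n → ℝ) → ℝ}
  {L l : ℝ} {Ω : Type*} {mΩ : MeasurableSpace Ω} {μ : Measure Ω} [IsProbabilityMeasure μ]
  {ℱ : Filtration ℕ mΩ} {σ G η lam : ℝ} {T : ℕ} {θ₀ : EuclideanSpace ℝ (Fin d)} {π₀ : Fin n → ℝ}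
  {θ gθ : ℕ → Ω → EuclideanSpace ℝ (Fin d)} {π gπ : ℕ → Ω → Fin n → ℝ}

lemma IsUnbiasedOracle.meanLE_step_error (ho : IsUnbiasedOracle μ ℱ f T σ G θ gθ π gπ)
    (hΦ : IsRegularObjective f h L l) (hL : 0 ≤ L) (hl : 0 ≤ l) (hη : 0 ≤ η) (hlam : 0 ≤ lam)
    (hrun : IsRun μ ℱ h T η lam θ₀ π₀ θ gθ π gπ)
    {X : EuclideanSpace ℝ (Fin d) → EuclideanSpace ℝ (Fin d)} (hX : Measurable X) {c : ℝ}
    (hc : ∀ x, ‖X x‖ ≤ c) {s : EuclideanSpace ℝ (Fin d) → Fin n → ℝ} (hs : Measurable s)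
    (hmem : ∀ x, s x ∈ stdSimplex ℝ (Fin n)) (B : ℕ) {t : ℕ} (ht : t < T) :
    MeanLE μ (fun ω => 2 * ⟪X (θ t ω), (μ[gθ t | ℱ t]) ω - gθ t ω⟫_ℝ
        + 2 * L * η * ‖gθ t ω‖ ^ 2
        + 4 * L * (2 * l * ‖θ t ω - θ (t / B * B) ω‖
          + (s (θ (t / B * B) ω) - π t ω) ⬝ᵥ ((μ[gπ t | ℱ t]) ω - gπ t ω)
          + lam * ‖gπ t ω‖ ^ 2))
      (2 * L * η * (l ^ 2 + σ ^ 2)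
        + 4 * L * (2 * l * (η * ((t % B : ℕ) * √(l ^ 2 + σ ^ 2))) + lam * G ^ 2)) := by
  have hanchor : t / B * B ≤ t := Nat.div_mul_le_self t B
  have hmod : t - t / B * B = t % B := by rw [Nat.mod_def, mul_comm]
  have hdrift := ho.meanLE_norm_sub_θ hΦ hl hη hrun hanchor ht
  rw [hmod] at hdrift
  have hγ : MeanLE μ (fun ω => ‖gπ t ω‖ ^ 2) (G ^ 2) :=
    ⟨(ho.memLp_π t ht).integrable_norm_pow two_ne_zero, ho.bound_π t ht⟩
  have hascent := ((hdrift.const_mul (by positivity : 0 ≤ 2 * l)).add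
    (ho.meanLE_dotProduct_noise hrun hs hmem hanchor ht)).add (hγ.const_mul hlam)
  have herror := (((ho.meanLE_inner_noise hrun hX hc ht).const_mul zero_le_two).add
    ((ho.meanLE_norm_sq_θ hΦ hl hrun ht).const_mul (by positivity : 0 ≤ 2 * L * η))).add
    (hascent.const_mul (by positivity : 0 ≤ 4 * L))
  simpa only [mul_zero, zero_add, add_zero] using herror

lemma IsRegularObjective.norm_gradient_moreauEnvelope_primal_le
    (hΦ : IsRegularObjective f h L l) (hl : 0 ≤ l) (hne : (stdSimplex ℝ (Fin n)).Nonempty)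
    (hb : BddBelow (Set.range (primal f h))) {ρ : ℝ} (hρ : 0 ≤ ρ) (x : EuclideanSpace ℝ (Fin d)) :
    ‖∇ (moreauEnvelope (primal f h) ρ) x‖ ≤ l :=
  norm_gradient_le_of_abs_sub_le hl
    (abs_moreauEnvelope_sub_le hρ hb (hΦ.abs_primal_sub_le hne)) x

lemma IsRun.memLp_gradient_moreauEnvelope (hrun : IsRun μ ℱ h T η lam θ₀ π₀ θ gθ π gπ)
    (hΦ : IsRegularObjective f h L l) (hl : 0 ≤ l) (hb : BddBelow (Set.range (primal f h)))
    {ρ : ℝ} (hρ : 0 ≤ ρ) {t : ℕ} (ht : t ≤ T) :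
    MemLp (fun ω => ∇ (moreauEnvelope (primal f h) ρ) (θ t ω)) 2 μ :=
  MemLp.of_bound ((measurable_gradient _).comp
      ((hrun.measurable_θ t ht).mono (ℱ.le t) le_rfl)).aestronglyMeasurable l
    (ae_of_all _ fun _ =>
      hΦ.norm_gradient_moreauEnvelope_primal_le hl ⟨π₀, hrun.init_mem⟩ hb hρ _)

lemma IsUnbiasedOracle.sum_integral_norm_sq_gradient_le
    (ho : IsUnbiasedOracle μ ℱ f T σ G θ gθ π gπ) (hΦ : IsRegularObjective f h L l)
    (hrun : IsRun μ ℱ h T η lam θ₀ π₀ θ gθ π gπ) (hL : 0 < L) (hl : 0 ≤ l)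
    (hb : BddBelow (Set.range (primal f h))) (hη : 0 < η) (hlam : 0 < lam) (hT : 0 < T)
    {R α : ℝ} (hR : 0 ≤ R) {pEmp : Fin n → ℝ} (hpEmp : pEmp ∈ stdSimplex ℝ (Fin n))
    (hα : 0 < α) (hαp : ∀ i, α ≤ pEmp i)
    (hKL : ∀ t < T, ∀ᵐ ω ∂μ, klDiv pEmp (π t ω) ≤ (R : EReal)) {B N : ℕ} (hB : 0 < B)
    (hTN : T ≤ N * B) :
    ∑ t ∈ range T, ∫ ω, ‖∇ (moreauEnvelope (primal f h) (1 / (2 * L))) (θ t ω)‖ ^ 2 ∂μ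
      ≤ 2 * (moreauEnvelope (primal f h) (1 / (2 * L)) θ₀
          - ⨅ y, moreauEnvelope (primal f h) (1 / (2 * L)) y) / η
        + 4 * L * (N * (1 / (2 * lam) * ((R + 1) / α))
          + (sSup (h '' stdSimplex ℝ (Fin n)) - h π₀))
        + T * (2 * L * η * (l ^ 2 + σ ^ 2) + 4 * L * (lam * G ^ 2))
        + 4 * L * (l * η * √(l ^ 2 + σ ^ 2) * (T * (B - 1))) := by
  have hne : (stdSimplex ℝ (Fin n)).Nonempty := ⟨_, hpEmp⟩
  have hρ : 0 ≤ 1 / (2 * L) := by positivity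
  refine le_of_forall_pos_le_add fun ε hε => ?_
  have : (0 : ℝ) < T := Nat.cast_pos.2 hT
  obtain ⟨s, hs, hmem, hsδ⟩ := hΦ.exists_measurable_primal_lt hne
    (by positivity : 0 < ε / (4 * L * T))
  have hpath := ho.ae_sum_norm_sq_gradient_le hΦ hrun hL hb hη hlam hT hR hpEmp hα hαp hKL hTN
    hmem fun y => (hsδ y).le
  have herror := MeanLE.sum fun t ht => ho.meanLE_step_error hΦ hL.le hl hη.le hlam.le hrun
    (measurable_gradient (moreauEnvelope (primal f h) (1 / (2 * L))))
    (hΦ.norm_gradient_moreauEnvelope_primal_le hl hne hb hρ) hs hmem B (mem_range.1 ht)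
  have hint : ∀ t ∈ range T, Integrable
      (fun ω => ‖∇ (moreauEnvelope (primal f h) (1 / (2 * L))) (θ t ω)‖ ^ 2) μ := fun t ht =>
    (hrun.memLp_gradient_moreauEnvelope hΦ hl hb hρ (mem_range.1 ht).le).integrable_norm_pow
      two_ne_zero
  rw [← integral_finsetSum _ hint]
  refine (((meanLE_const _).add herror).of_nonneg_of_le (integrable_finsetSum _ hint).1
    (ae_of_all _ fun ω => sum_nonneg fun t _ => sq_nonneg _) hpath).2.trans ?_
  have hdrift := mul_le_mul_of_nonneg_left (two_mul_sum_range_mod_le T hB)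
    (by positivity : 0 ≤ 4 * L * (l * η * √(l ^ 2 + σ ^ 2)))
  have hδ : 4 * L * (T * (ε / (4 * L * T))) = ε := by field_simp
  simp only [sum_add_distrib, sum_const, card_range, nsmul_eq_mul, ← mul_sum, ← sum_mul]
  linear_combination hdrift + hδ

end ExpectedRate

section Rate

lemma exists_pow_four_eq {x : ℝ} (hx : 1 ≤ x) : ∃ r : ℝ, 1 ≤ r ∧ x = r ^ 4 ∧
    x ^ (-(1 / 4) : ℝ) = r⁻¹ ∧ x ^ (-(3 / 4) : ℝ) = r⁻¹ ^ 3 := by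
  have hx0 : 0 ≤ x := zero_le_one.trans hx
  refine ⟨x ^ (1 / 4 : ℝ), Real.one_le_rpow hx (by norm_num), ?_, Real.rpow_neg hx0 _, ?_⟩
  · rw [← Real.rpow_natCast, ← Real.rpow_mul hx0]
    norm_num
  · rw [← Real.rpow_neg hx0, ← Real.rpow_natCast, ← Real.rpow_mul hx0]
    norm_num

lemma one_div_pow_four_mul_le {A D H K S V G L l r b : ℝ} (hr : 1 ≤ r) (hL : 0 ≤ L) (hl : 0 ≤ l)
    (hK : 0 ≤ K) (hS : 0 ≤ S) (hV : 0 ≤ V) (hb : b ≤ r ^ 2 + 1)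
    (hA : A ≤ 2 * D / r⁻¹ ^ 3 + 4 * L * (b * (1 / (2 * r⁻¹) * K) + H)
      + r ^ 4 * (2 * L * r⁻¹ ^ 3 * V + 4 * L * (r⁻¹ * G ^ 2))
      + 4 * L * (l * r⁻¹ ^ 3 * S * (r ^ 4 * (b - 1)))) :
    1 / r ^ 4 * A
      ≤ (2 * D + 4 * L * (K + G ^ 2 + l * S) + 2 * L * V) * r⁻¹ + 4 * L * H / r ^ 4 := by
  have : 0 < r := zero_lt_one.trans_le hr
  have hr2 : 1 ≤ r ^ 2 := one_le_pow₀ hr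
  have hrestart : 2 * L * K * r * b ≤ 2 * L * K * r * (2 * r ^ 2) := by gcongr; linarith
  have hdrift : 4 * L * l * S * r * (b - 1) ≤ 4 * L * l * S * r * r ^ 2 := by gcongr; linarith
  have hnoise : 2 * L * V * r * 1 ≤ 2 * L * V * r * r ^ 2 := by gcongr
  have hA' : A ≤ (2 * D + 4 * L * (K + G ^ 2 + l * S) + 2 * L * V) * r ^ 3 + 4 * L * H := by
    refine hA.trans ?_
    field_simp
    linear_combination 2 * (hrestart + hdrift + hnoise)
  calc 1 / r ^ 4 * A
      ≤ 1 / r ^ 4 * ((2 * D + 4 * L * (K + G ^ 2 + l * S) + 2 * L * V) * r ^ 3 + 4 * L * H) := by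
        gcongr
    _ = _ := by field_simp

lemma mul_rpow_add_div_le_sq {a b x ε : ℝ} (hε : 0 < ε) (hx : 1 ≤ x) (hb : 0 ≤ b)
    (h : (a + b) ^ 4 * ε ^ (-8 : ℤ) ≤ x) : a * x ^ (-(1 / 4) : ℝ) + b / x ≤ ε ^ 2 := by
  obtain ⟨r, hr, hxr, hrpow, -⟩ := exists_pow_four_eq hx
  have hr0 : 0 < r := zero_lt_one.trans_le hr
  rw [zpow_neg, ← div_eq_mul_inv, div_le_iff₀ (by positivity)] at h
  have hsum : a + b ≤ ε ^ 2 * r := le_of_pow_le_pow_left₀ four_ne_zero (by positivity)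
    (h.trans_eq (by rw [hxr]; norm_cast; ring))
  rw [hrpow, hxr]
  calc a * r⁻¹ + b / r ^ 4 ≤ a * r⁻¹ + b / r := by gcongr; exact le_self_pow₀ hr four_ne_zero
    _ = (a + b) / r := by ring
    _ ≤ ε ^ 2 := (div_le_iff₀ hr0).2 hsum

lemma average_integral_norm_le_sqrt {Ω : Type*} {mΩ : MeasurableSpace Ω} {μ : Measure Ω}
    [IsProbabilityMeasure μ] {E : Type*} [NormedAddCommGroup E] {X : ℕ → Ω → E} {T : ℕ}
    (hX : ∀ t < T, MemLp (X t) 2 μ) :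
    1 / (T : ℝ) * ∑ t ∈ range T, ∫ ω, ‖X t ω‖ ∂μ
      ≤ √(1 / (T : ℝ) * ∑ t ∈ range T, ∫ ω, ‖X t ω‖ ^ 2 ∂μ) := by
  have hjensen : ∀ t ∈ range T, (∫ ω, ‖X t ω‖ ∂μ) ^ 2 ≤ ∫ ω, ‖X t ω‖ ^ 2 ∂μ := fun t ht => by
    have hXt := hX t (mem_range.1 ht)
    have hsq : MeanLE μ (fun ω => ‖X t ω‖ ^ 2) (∫ ω, ‖X t ω‖ ^ 2 ∂μ) :=
      ⟨hXt.integrable_norm_pow two_ne_zero, le_rfl⟩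
    exact (Real.le_sqrt (integral_nonneg fun _ => norm_nonneg _)
      (integral_nonneg fun _ => sq_nonneg _)).1 (hsq.norm_of_norm_sq hXt.1).2
  have haverage := sum_div_card_sq_le_sum_sq_div_card (s := range T)
    (f := fun t => ∫ ω, ‖X t ω‖ ∂μ)
  rw [card_range] at haverage
  rw [one_div_mul_eq_div, one_div_mul_eq_div]
  refine Real.le_sqrt_of_sq_le (haverage.trans ?_)
  gcongr with t ht
  exact hjensen t ht

lemma exists_lt_le_of_average_le {a : ℕ → ℝ} {ε : ℝ} {T : ℕ} (hT : 0 < T)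
    (h : 1 / (T : ℝ) * ∑ t ∈ range T, a t ≤ ε) : ∃ t < T, a t ≤ ε := by
  rw [one_div_mul_eq_div, div_le_iff₀ (Nat.cast_pos.2 hT)] at h
  obtain ⟨t, ht, hle⟩ := exists_le_of_sum_le (nonempty_range_iff.2 hT.ne')
    (f := a) (g := fun _ => ε) (by simpa [mul_comm] using h)
  exact ⟨t, mem_range.1 ht, hle⟩

lemma IsUnbiasedOracle.average_integral_norm_sq_gradient_le {d n : ℕ}
    {f : EuclideanSpace ℝ (Fin d) → (Fin n → ℝ) → ℝ} {h : (Fin n → ℝ) → ℝ}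
    {Ω : Type*} {mΩ : MeasurableSpace Ω} {μ : Measure Ω} [IsProbabilityMeasure μ]
    {ℱ : Filtration ℕ mΩ} {L l σ G R α : ℝ} {T : ℕ} {θ₀ : EuclideanSpace ℝ (Fin d)}
    {π₀ : Fin n → ℝ} {θ gθ : ℕ → Ω → EuclideanSpace ℝ (Fin d)} {π gπ : ℕ → Ω → Fin n → ℝ}
    (ho : IsUnbiasedOracle μ ℱ f T σ G θ gθ π gπ) (hΦ : IsRegularObjective f h L l)
    (hrun : IsRun μ ℱ h T ((T : ℝ) ^ (-(3 / 4) : ℝ)) ((T : ℝ) ^ (-(1 / 4) : ℝ)) θ₀ π₀ θ gθ π gπ)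
    (hL : 0 < L) (hl : 0 ≤ l) (hb : BddBelow (Set.range (primal f h))) (hT : 1 ≤ T) (hR : 0 ≤ R)
    {pEmp : Fin n → ℝ} (hpEmp : pEmp ∈ stdSimplex ℝ (Fin n)) (hα : 0 < α)
    (hαp : ∀ i, α ≤ pEmp i) (hKL : ∀ t < T, ∀ᵐ ω ∂μ, klDiv pEmp (π t ω) ≤ (R : EReal)) :
    1 / (T : ℝ) * ∑ t ∈ range T,
        ∫ ω, ‖∇ (moreauEnvelope (primal f h) (1 / (2 * L))) (θ t ω)‖ ^ 2 ∂μ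
      ≤ rateConst L l σ G R α (moreauEnvelope (primal f h) (1 / (2 * L)) θ₀
          - ⨅ y, moreauEnvelope (primal f h) (1 / (2 * L)) y) * (T : ℝ) ^ (-(1 / 4) : ℝ)
        + 4 * L * (sSup (h '' stdSimplex ℝ (Fin n)) - h π₀) / T := by
  obtain ⟨r, hr, hTr, hlam, hη⟩ := exists_pow_four_eq (Nat.one_le_cast.2 hT)
  have hr0 : 0 < r := zero_lt_one.trans_le hr
  have hblock : r ^ 2 ≤ ⌈r ^ 2⌉₊ := Nat.le_ceil _
  have hcover : T ≤ ⌈r ^ 2⌉₊ * ⌈r ^ 2⌉₊ := by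
    have : (T : ℝ) ≤ ⌈r ^ 2⌉₊ * ⌈r ^ 2⌉₊ := by
      calc (T : ℝ) = r ^ 2 * r ^ 2 := by rw [hTr]; ring
        _ ≤ _ := by gcongr
    exact_mod_cast this
  rw [hlam, hη] at hrun
  have hsum := ho.sum_integral_norm_sq_gradient_le hΦ hrun hL hl hb (by positivity)
    (by positivity) hT hR hpEmp hα hαp hKL (Nat.ceil_pos.2 (by positivity)) hcover
  rw [hlam, hTr]
  rw [hTr] at hsum
  exact one_div_pow_four_mul_le hr hL.le hl (by positivity) (Real.sqrt_nonneg _) (by positivity)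
    (Nat.ceil_lt_add_one (by positivity)).le hsum

end Rate

end SaddlePoint

theorem theorem1
    {d n : ℕ} {Ω : Type*} {mΩ : MeasurableSpace Ω} (μ : Measure Ω) [IsProbabilityMeasure μ]
    (ℱ : Filtration ℕ mΩ)
    (f : EuclideanSpace ℝ (Fin d) → (Fin n → ℝ) → ℝ) (h : (Fin n → ℝ) → ℝ)
    (L l σ G R α : ℝ) (hL : 0 < L) (hl : 0 ≤ l) (hσ : 0 ≤ σ) (hG : 0 ≤ G) (hR : 0 ≤ R)
    (hΦ : SaddlePoint.IsRegularObjective f h L l)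
    (hF : BddBelow (Set.range (SaddlePoint.primal f h)))
    (pEmp : Fin n → ℝ) (hpEmp : pEmp ∈ stdSimplex ℝ (Fin n))
    (hα : 0 < α) (hαp : ∀ i, α ≤ pEmp i)
    (T : ℕ) (hT : 1 ≤ T)
    (θ₀ : EuclideanSpace ℝ (Fin d)) (π₀ : Fin n → ℝ)
    (θ gθ : ℕ → Ω → EuclideanSpace ℝ (Fin d)) (π gπ : ℕ → Ω → Fin n → ℝ)
    (hrun : SaddlePoint.IsRun μ ℱ h T ((T : ℝ) ^ (-(3 / 4) : ℝ)) ((T : ℝ) ^ (-(1 / 4) : ℝ))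
      θ₀ π₀ θ gθ π gπ)
    (horacle : SaddlePoint.IsUnbiasedOracle μ ℱ f T σ G θ gθ π gπ)
    (hKL : ∀ t < T, ∀ᵐ ω ∂μ, SaddlePoint.klDiv pEmp (π t ω) ≤ (R : EReal)) :
    let M : EuclideanSpace ℝ (Fin d) → ℝ :=
      SaddlePoint.moreauEnvelope (SaddlePoint.primal f h) (1 / (2 * L))
    let D : ℝ := M θ₀ - ⨅ x, M x
    let H : ℝ := sSup (h '' stdSimplex ℝ (Fin n)) - h π₀
    let C : ℝ := SaddlePoint.rateConst L l σ G R α D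
    Differentiable ℝ M ∧
    (∀ t < T, Integrable (fun ω => ‖gradient M (θ t ω)‖ ^ 2) μ) ∧
    (1 / (T : ℝ)) * ∑ t ∈ Finset.range T, ∫ ω, ‖gradient M (θ t ω)‖ ^ 2 ∂μ
      ≤ C * (T : ℝ) ^ (-(1 / 4) : ℝ) + 4 * L * H / T ∧
    (∀ ε : ℝ, 0 < ε → (C + 4 * L * H) ^ 4 * ε ^ (-8 : ℤ) ≤ T →
      (1 / (T : ℝ)) * ∑ t ∈ Finset.range T, ∫ ω, ‖gradient M (θ t ω)‖ ∂μ ≤ ε ∧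
      ∃ t < T, ∫ ω, ‖gradient M (θ t ω)‖ ∂μ ≤ ε) := by
  intro M D H C
  have hne : (stdSimplex ℝ (Fin n)).Nonempty := ⟨_, hpEmp⟩
  have hρ : 0 < 1 / (2 * L) := by positivity
  have hρL : 1 / (2 * L) * L < 1 := by field_simp; norm_num
  have hMLp : ∀ t < T, MemLp (fun ω => gradient M (θ t ω)) 2 μ := fun t ht =>
    hrun.memLp_gradient_moreauEnvelope hΦ hl hF hρ.le ht.le
  have hrate := horacle.average_integral_norm_sq_gradient_le hΦ hrun hL hl hF hT hR hpEmp hα hαp hKL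
  refine ⟨SaddlePoint.differentiable_moreauEnvelope hρ hρL (hΦ.strongConvexOn_primal hne)
    (hΦ.continuous_primal hne) hF, fun t ht => (hMLp t ht).integrable_norm_pow two_ne_zero, hrate,
    fun ε hε hTε => ?_⟩
  have hH : 0 ≤ 4 * L * H :=
    mul_nonneg (by positivity) (sub_nonneg.2 (hΦ.le_sSup_image hrun.init_mem))
  have haverage := (SaddlePoint.average_integral_norm_le_sqrt hMLp).trans
    (Real.sqrt_le_iff.2 ⟨hε.le, hrate.trans
      (SaddlePoint.mul_rpow_add_div_le_sq hε (Nat.one_le_cast.2 hT) hH hTε)⟩)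
  exact ⟨haverage, SaddlePoint.exists_lt_le_of_average_le hT haverage⟩
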